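/- Let $n\ge 1$ be an integer. Let $\check{\mathcal O}_{\mathbb P^1}(-n)$ be the one-point orbifold compactification, by a point $\check q$ with group $\Gamma_n=\mathbb Z/n\mathbb Z$, of the total space of the line bundle $\mathcal O_{\mathbb P^1}(-n)$, with radial coordinate $\hat r\in[0,\infty]$ ($\hat r=0$ on the zero section $\mathbb P^1$, $\hat r=\infty$ at $\check q$), and put $s=1/\hat r$. Equip it with the $\mathrm U(2)$-invariant orbifold metric $$\check g_{LEB(n)}=\frac{1}{(n+\hat r^2)^2}\Big[\frac{1+\hat r^2}{n+\hat r^2}\,d\hat r^2+(1+\hat r^2)(\sigma_1^2+\sigma_2^2)+\frac{\hat r^2(n+\hat r^2)}{1+\hat r^2}\,\sigma_3^2\Big],$$ where $\sigma_1,\sigma_2,\sigma_3$ is the left-invariant coframe on $S^3=SU(2)$ for which $\sigma_1^2+\sigma_2^2+\sigma_3^2$ is the round metric of the unit sphere and $\sigma_3$ is dual to the Hopf direction; the metric extends smoothly over $\mathbb P^1$ and, in the orbifold sense, over $\check q$. Let $\mathcal X_n$ be the set of smooth (in the orbifold sense), $\mathrm U(2)$-invariant, positive functions on $\check{\mathcal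 O}_{\mathbb P^1}(-n)$; each of them is a function of $s\in[0,\infty]$. Let $$\mathcal X_{n,-}=\{K\in\mathcal X_n:\ \Delta_{\check g_{LEB(n)}}K(\check q)-4(n-2)K(\check q)<0\}.$$ For $K\in\mathcal X_n$ consider the equation $$-\Delta_{\check g_{LEB(n)}}u+\tfrac16R_{\check g_{LEB(n)}}u=Ku^3,\qquad u\in\mathcal X_n,\qquad (*)$$ where $\Delta$ is the Laplace-Beltrami operator and $R$ the scalar curvature. **Theorem.** Let $n\ge1$ and let $K_{2,-}\in\mathcal X_n$ be a monotonically decreasing (that is, non-increasing) function of $s$. Put $$K_{n,-}(s)=\frac{2+ns^2}{n+ns^2}\,K_{2,-}(s)$$ (the factor being $1$ at $s=\infty$). Then $K_{n,-}\in\mathcal X_n$, and equation $(*)$ with $K=K_{n,-}$ has no solution $u\in\mathcal X_n$. Moreover, if $K_{2,-}''(0)<0$ (second derivative in $s$), then $K_{n,-}\in\mathcal X_{n,-}$. In particular, for $n\ge2$ and every constant $K>0$, equation $(*)$ has no solution $u\in\mathcal X_n$, i.e. the Yamabe problem on $(\check{\mathcal O}_{\mathbb P^1}(-n),\check g_{LEB(n)})$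 has no $\mathrm U(2)$-invariant solution. -/

import Mathlib

open scoped ENNReal ContDiff

noncomputable section

/-! ### Riemannian geometry in a coordinate chart on `ℝ^d`

A metric is given by its matrix `G x i j = g(∂ᵢ, ∂ⱼ)` at the point `x`. -/

namespace ChartGeometry

variable {d : ℕ}

/-- The partial derivative `∂ᵢ f`. -/
def pd (i : Fin d) (f : (Fin d → ℝ) → ℝ) (x : Fin d → ℝ) : ℝ :=
  fderiv ℝ f x (Pi.single i 1)

/-- `Γᵏᵢⱼ = ½ ∑ₗ gᵏˡ (∂ᵢ gⱼₗ + ∂ⱼ gᵢₗ - ∂ₗ gᵢⱼ)`. -/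
def christoffel (G : (Fin d → ℝ) → Matrix (Fin d) (Fin d) ℝ) (k i j : Fin d)
    (x : Fin d → ℝ) : ℝ :=
  (1 / 2) * ∑ l, (G x)⁻¹ k l *
    (pd i (fun z => G z j l) x + pd j (fun z => G z i l) x - pd l (fun z => G z i j) x)

/-- `Ricᵢⱼ = ∑ₖ (∂ₖ Γᵏᵢⱼ - ∂ⱼ Γᵏᵢₖ + ∑ₗ (Γᵏₖₗ Γˡᵢⱼ - Γᵏⱼₗ Γˡᵢₖ))`. -/
def ricci (G : (Fin d → ℝ) → Matrix (Fin d) (Fin d) ℝ) (i j : Fin d) (x : Fin d → ℝ) : ℝ :=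
  ∑ k, (pd k (christoffel G k i j) x - pd j (christoffel G k i k) x +
    ∑ l, (christoffel G k k l x * christoffel G l i j x -
      christoffel G k j l x * christoffel G l i k x))

/-- The scalar curvature `R = ∑ gⁱʲ Ricᵢⱼ` (positive on round spheres). -/
def scalarCurvature (G : (Fin d → ℝ) → Matrix (Fin d) (Fin d) ℝ) (x : Fin d → ℝ) : ℝ :=
  ∑ i, ∑ j, (G x)⁻¹ i j * ricci G i j x

/-- The Laplace-Beltrami operator as the trace of the Hessian,
`Δ f = ∑ gⁱʲ (∂ᵢ∂ⱼ f - ∑ₖ Γᵏᵢⱼ ∂ₖ f)`. -/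
def laplacian (G : (Fin d → ℝ) → Matrix (Fin d) (Fin d) ℝ) (f : (Fin d → ℝ) → ℝ)
    (x : Fin d → ℝ) : ℝ :=
  ∑ i, ∑ j, (G x)⁻¹ i j * (pd i (pd j f) x - ∑ k, christoffel G k i j x * pd k f x)

end ChartGeometry

/-! ### The compactified LeBrun orbifold

The total space of `𝒪(-n) → ℙ¹` is `(S³ × ℂ)/U(1)` with `λ · (w, y) = (λ w, λ⁻ⁿ y)`. Allowing also
positive real rescalings of `(w, y)`, it is the part `w ≠ 0` of the quotient of `(ℂ² × ℂ) ∖ {0}`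
by `ℝ_{>0} × U(1)`. The part `w = 0` is one point `q`, the orbifold point. The radial coordinate is
`r̂ = |y| / |w|`, and `s = 1 / r̂ = |w| / |y|`: the zero section `ℙ¹` is `s = ∞`, and `q` is
`s = 0`. The part `y ≠ 0` is `ℂ² / Γ_n` through `w ↦ [w : 1]`, `Γ_n` the `n`-th roots of unity. -/

namespace LeBrun

/-- Nonzero homogeneous coordinates `(w, y) ∈ ℂ² × ℂ`. -/
abbrev Hom : Type := {h : (Fin 2 → ℂ) × ℂ // h ≠ 0}

/-- `(w, y) ∼ (c λ w, c λ⁻ⁿ y)` for `c > 0` and `λ ∈ U(1)`. -/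
def rel (n : ℕ) (h h' : Hom) : Prop :=
  ∃ c : ℝ, 0 < c ∧ ∃ l : Circle,
    h'.1.1 = ((c : ℂ) * (l : ℂ)) • h.1.1 ∧ h'.1.2 = ((c : ℂ) * ((l⁻¹ ^ n : Circle) : ℂ)) * h.1.2

lemma rel_equivalence (n : ℕ) : Equivalence (rel n) where
  refl h := ⟨1, one_pos, 1, by simp, by simp⟩
  symm := by
    rintro h h' ⟨c, hc, l, h1, h2⟩
    have hc' : (c : ℂ) ≠ 0 := by exact_mod_cast hc.ne'
    have hl : (l : ℂ) ≠ 0 := Circle.coe_ne_zero l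
    refine ⟨c⁻¹, inv_pos.2 hc, l⁻¹, ?_, ?_⟩
    · rw [h1, smul_smul]
      push_cast
      rw [show (c : ℂ)⁻¹ * (l : ℂ)⁻¹ * ((c : ℂ) * (l : ℂ)) = 1 by field_simp, one_smul]
    · have hln : ((l : ℂ)⁻¹) ^ n * (l : ℂ) ^ n = 1 := by
        rw [← mul_pow, inv_mul_cancel₀ hl, one_pow]
      rw [h2]
      push_cast
      rw [inv_inv, show (c : ℂ)⁻¹ * (l : ℂ) ^ n * ((c : ℂ) * (l : ℂ)⁻¹ ^ n * h.1.2)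
        = ((c : ℂ)⁻¹ * (c : ℂ)) * ((l : ℂ)⁻¹ ^ n * (l : ℂ) ^ n) * h.1.2 by ring, hln,
        inv_mul_cancel₀ hc', one_mul, one_mul]
  trans := by
    rintro h h' h'' ⟨c, hc, l, h1, h2⟩ ⟨c', hc', l', h1', h2'⟩
    refine ⟨c' * c, mul_pos hc' hc, l' * l, ?_, ?_⟩
    · rw [h1', h1, smul_smul]
      congr 1
      push_cast
      ring
    · rw [h2', h2]
      push_cast
      rw [mul_inv, mul_pow]
      ring

/-- The equivalence relation `rel n` as a setoid. -/
def setoid (n : ℕ) : Setoid Hom := ⟨rel n, rel_equivalence n⟩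

/-- The compact orbifold `𝒪̌_{ℙ¹}(-n)`. -/
def Orb (n : ℕ) : Type := Quotient (setoid n)

/-- The point `[w : y]`. -/
def mk (n : ℕ) (h : Hom) : Orb n := Quotient.mk (setoid n) h

/-- `|w|²`. -/
def wSq (h : (Fin 2 → ℂ) × ℂ) : ℝ := Complex.normSq (h.1 0) + Complex.normSq (h.1 1)

/-- `|y|²`. -/
def ySq (h : (Fin 2 → ℂ) × ℂ) : ℝ := Complex.normSq h.2

/-- The radial coordinate `s = |w| / |y| ∈ [0, ∞]`. -/
def s (n : ℕ) : Orb n → ℝ≥0∞ :=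
  Quotient.lift
    (fun h : Hom => ENNReal.ofReal (√(wSq h.1)) / ENNReal.ofReal (√(ySq h.1))) (by
      rintro h h' ⟨c, hc, l, h1, h2⟩
      have e1 : wSq h'.1 = c ^ 2 * wSq h.1 := by
        simp only [wSq, h1, Pi.smul_apply, smul_eq_mul, Complex.normSq_mul, Circle.normSq_coe,
          Complex.normSq_ofReal]
        ring
      have e2 : ySq h'.1 = c ^ 2 * ySq h.1 := by
        simp only [ySq, h2, Complex.normSq_mul, Circle.normSq_coe, Complex.normSq_ofReal]
        ring
      have hc0 : ENNReal.ofReal c ≠ 0 := by simpa using hc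
      simp only [e1, e2, Real.sqrt_mul (sq_nonneg c), Real.sqrt_sq hc.le,
        ENNReal.ofReal_mul hc.le]
      exact (ENNReal.mul_div_mul_left _ _ hc0 ENNReal.ofReal_ne_top).symm)

/-- The action of `U(2)`, `A · [w : y] = [A w : y]`. -/
def act (n : ℕ) (A : Matrix.unitaryGroup (Fin 2) ℂ) : Orb n → Orb n :=
  Quotient.map
    (fun h : Hom => ⟨((A : Matrix (Fin 2) (Fin 2) ℂ).mulVec h.1.1, h.1.2), by
      intro h0
      apply h.2
      have hw := congrArg Prod.fst h0
      have hy := congrArg Prod.snd h0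
      simp only [Prod.fst_zero, Prod.snd_zero] at hw hy
      have := congrArg (star (A : Matrix (Fin 2) (Fin 2) ℂ)).mulVec hw
      rw [Matrix.mulVec_mulVec, Matrix.UnitaryGroup.star_mul_self, Matrix.one_mulVec,
        Matrix.mulVec_zero] at this
      exact Prod.ext this hy⟩)
    (by
      rintro h h' ⟨c, hc, l, h1, h2⟩
      refine ⟨c, hc, l, ?_, h2⟩
      simp only [h1, Matrix.mulVec_smul])

/-- The three affine charts in homogeneous coordinates: `[x₀ + i x₁ : x₂ + i x₃ : 1]`, the orbifold
chart `ℂ² → ℂ² / Γ_n` centred at `q`, and the bundle charts `[1 : x₀ + i x₁ : x₂ + i x₃]` and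
`[x₀ + i x₁ : 1 : x₂ + i x₃]` of `𝒪(-n)`. -/
def homChart (k : Fin 3) (x : Fin 4 → ℝ) : (Fin 2 → ℂ) × ℂ :=
  match k with
  | 0 => (![⟨x 0, x 1⟩, ⟨x 2, x 3⟩], 1)
  | 1 => (![1, ⟨x 0, x 1⟩], ⟨x 2, x 3⟩)
  | 2 => (![⟨x 0, x 1⟩, 1], ⟨x 2, x 3⟩)

lemma homChart_ne_zero (k : Fin 3) (x : Fin 4 → ℝ) : homChart k x ≠ 0 := by
  intro h
  have h0 := congrFun (congrArg Prod.fst h) 0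
  have h1 := congrFun (congrArg Prod.fst h) 1
  have h2 := congrArg Prod.snd h
  fin_cases k <;> simp [homChart] at h0 h1 h2

/-- The charts `ℝ⁴ → 𝒪̌(-n)`; chart `0` is the orbifold chart, with `q` at the origin. The first
is an `n`-fold quotient map off the origin, the other two are injective. -/
def chart (n : ℕ) (k : Fin 3) (x : Fin 4 → ℝ) : Orb n :=
  mk n ⟨homChart k x, homChart_ne_zero k x⟩

/-- The orbifold point `q`. -/
def q (n : ℕ) : Orb n := chart n 0 0

/-! ### The metric -/

/-- `⟨w, w(u)⟩ = ∑ conj(wₖ) uₖ`; its real part is `|w| d|w|`, its imaginary part `|w|² θ` with `θ`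
the Hopf form on `S³`. -/
def wForm (h u : (Fin 2 → ℂ) × ℂ) : ℂ :=
  (starRingEnd ℂ) (h.1 0) * u.1 0 + (starRingEnd ℂ) (h.1 1) * u.1 1

/-- `conj(y) dy`. -/
def yForm (h u : (Fin 2 → ℂ) × ℂ) : ℂ := (starRingEnd ℂ) h.2 * u.2

/-- The metric `ǧ = (n + r̂²)⁻² g_LEB(n)`, pulled back to homogeneous coordinates at `h = (w, y)` and
evaluated on `u, v`. This expression is regular also at `w = 0` and at `y = 0`; where
`w ≠ 0 ≠ y` it is the expression in `dr̂, σ₁, σ₂, σ₃`, see `homMetric_eq`. -/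
def homMetric (n : ℕ) (h u v : (Fin 2 → ℂ) × ℂ) : ℝ :=
  let N : ℝ := n
  let W := wSq h
  let Y := ySq h
  (1 / (N * W + Y) ^ 2) *
    ((W + Y) * (wForm u v).re
      + (W + Y) / (N * W + Y) *
          (W * (yForm u v).re
            - ((yForm h u).re * (wForm h v).re + (yForm h v).re * (wForm h u).re)
            - N * ((wForm h u).re * (wForm h v).re))
      + ((N - 2) * Y - W) / (W + Y) * ((wForm h u).im * (wForm h v).im)
      + (N * W + Y) / (N * (W + Y)) *
          ((wForm h u).im * (yForm h v).im + (wForm h v).im * (yForm h u).im)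
      + (1 - N) * W * (2 * N * W + (N + 1) * Y) / (N ^ 2 * (W + Y) * (N * W + Y)) *
          ((yForm h u).im * (yForm h v).im))

/-- `r̂ = |y| / |w|`. -/
def rHat (h : (Fin 2 → ℂ) × ℂ) : ℝ := √(ySq h) / √(wSq h)

/-- The differential of `r̂`: `dr̂ = r̂ (|y|⁻¹ d|y| - |w|⁻¹ d|w|)`. -/
def drHat (h u : (Fin 2 → ℂ) × ℂ) : ℝ :=
  rHat h * ((yForm h u).re / ySq h - (wForm h u).re / wSq h)

/-- `σ₃`: the Hopf form of `w / |w| ∈ S³` where `y > 0`, and its extension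
`Im⟨w, dw⟩ / |w|² + n⁻¹ d(arg y)` invariant under `(w, y) ↦ (λ w, λ⁻ⁿ y)`. -/
def sigma3 (n : ℕ) (h u : (Fin 2 → ℂ) × ℂ) : ℝ :=
  (wForm h u).im / wSq h + (yForm h u).im / ((n : ℝ) * ySq h)

/-- `σ₁² + σ₂²`: the Fubini-Study form, that is the round metric of the unit sphere `S³` minus the
square of its Hopf form. -/
def sigma12 (h u v : (Fin 2 → ℂ) × ℂ) : ℝ :=
  ((wForm u v).re - ((wForm h u).re * (wForm h v).re + (wForm h u).im * (wForm h v).im) / wSq h)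
    / wSq h

lemma re_mul_re_add_im_mul_im (h u v : (Fin 2 → ℂ) × ℂ) :
    (yForm h u).re * (yForm h v).re + (yForm h u).im * (yForm h v).im
      = ySq h * (yForm u v).re := by
  simp only [yForm, ySq, Complex.mul_re, Complex.mul_im, Complex.conj_re, Complex.conj_im,
    Complex.normSq_apply]
  ring

/-- Where `w ≠ 0 ≠ y`, `homMetric` is
`(n + r̂²)⁻² [(1+r̂²)/(n+r̂²) dr̂² + (1+r̂²)(σ₁²+σ₂²) + r̂²(n+r̂²)/(1+r̂²) σ₃²]`. -/
lemma homMetric_eq (n : ℕ) (hn : 1 ≤ n) (h u v : (Fin 2 → ℂ) × ℂ)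
    (hW : 0 < wSq h) (hY : 0 < ySq h) :
    homMetric n h u v = (1 / ((n : ℝ) + rHat h ^ 2) ^ 2) *
      ((1 + rHat h ^ 2) / (n + rHat h ^ 2) * (drHat h u * drHat h v)
        + (1 + rHat h ^ 2) * sigma12 h u v
        + rHat h ^ 2 * (n + rHat h ^ 2) / (1 + rHat h ^ 2) * (sigma3 n h u * sigma3 n h v)) := by
  have hN : (0 : ℝ) < n := by exact_mod_cast hn
  have hr : rHat h ^ 2 = ySq h / wSq h := by
    rw [rHat, div_pow, Real.sq_sqrt hY.le, Real.sq_sqrt hW.le]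
  have hd : drHat h u * drHat h v = ySq h / wSq h *
      (((yForm h u).re / ySq h - (wForm h u).re / wSq h) *
        ((yForm h v).re / ySq h - (wForm h v).re / wSq h)) := by
    rw [← hr, drHat, drHat]; ring
  have hy : (yForm u v).re
      = ((yForm h u).re * (yForm h v).re + (yForm h u).im * (yForm h v).im) / ySq h := by
    rw [re_mul_re_add_im_mul_im]; field_simp
  rw [hd, hr, homMetric]
  simp only [sigma12, sigma3, hy]
  generalize wSq h = W at *
  generalize ySq h = Y at *
  generalize (n : ℝ) = N at *
  have h1 : N * W + Y ≠ 0 := by positivity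
  have h2 : W + Y ≠ 0 := by positivity
  have e1 : N + Y / W = (N * W + Y) / W := by field_simp
  have e2 : 1 + Y / W = (W + Y) / W := by field_simp
  rw [e1, e2]
  field_simp
  ring

/-- The matrix of `ǧ` in the chart `k`. -/
def metric (n : ℕ) (k : Fin 3) (x : Fin 4 → ℝ) : Matrix (Fin 4) (Fin 4) ℝ :=
  Matrix.of fun i j => homMetric n (homChart k x)
    (fderiv ℝ (homChart k) x (Pi.single i 1)) (fderiv ℝ (homChart k) x (Pi.single j 1))

/-! ### Function spaces and the equation -/

/-- `𝒳_n`: the smooth (in the orbifold sense), `U(2)`-invariant, positive functions. -/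
def X (n : ℕ) : Set (Orb n → ℝ) :=
  {f | (∀ k, ContDiff ℝ ∞ (f ∘ chart n k)) ∧ (∀ A p, f (act n A p) = f p) ∧ ∀ p, 0 < f p}

/-- `𝒳_{n,-}`: those `K ∈ 𝒳_n` with `Δ K(q) - 4 (n - 2) K(q) < 0`. -/
def XNeg (n : ℕ) : Set (Orb n → ℝ) :=
  {K | K ∈ X n ∧
    ChartGeometry.laplacian (metric n 0) (K ∘ chart n 0) 0 - 4 * ((n : ℝ) - 2) * K (q n) < 0}

/-- `u` solves `-Δ u + (R / 6) u = K u³` at every point of the orbifold, in every chart. -/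
def Solves (n : ℕ) (K u : Orb n → ℝ) : Prop :=
  ∀ k x, -ChartGeometry.laplacian (metric n k) (u ∘ chart n k) x
      + (1 / 6) * ChartGeometry.scalarCurvature (metric n k) x * u (chart n k x)
    = K (chart n k x) * u (chart n k x) ^ 3

/-- `(2 + n s²) / (n + n s²)`, with its limit value `1` at `s = ∞`. -/
def factor (n : ℕ) (p : Orb n) : ℝ :=
  if s n p = ⊤ then 1
  else (2 + n * (s n p).toReal ^ 2) / (n + n * (s n p).toReal ^ 2)

/-- `K_{n,-} = (2 + n s²) / (n + n s²) · K_{2,-}`. -/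
def KMinus (n : ℕ) (K₂ : Orb n → ℝ) (p : Orb n) : ℝ := factor n p * K₂ p

/-- A `U(2)`-invariant function `f` as a function of the coordinate `s ≥ 0`; for `t < 0` this is the
even extension `f(|t|)`. -/
def radial (n : ℕ) (f : Orb n → ℝ) (t : ℝ) : ℝ := f (chart n 0 ![t, 0, 0, 0])

end LeBrun

end

/-!
By `U(2)`-invariance a solution `u` of the equation for `K_{n,-}` is a function `φ` of `w = s²`, and
the equation becomes an ordinary differential equation on `w > 0`. Here `Δ` and `R` are needed only
at the points of one real axis of the orbifold chart, where the metric is diagonal. The substitution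
`1 + n w = e^{2τ}`, `v = w φ / (1 + n w)` turns it into the Emden-Fowler equation `v'' = -Q v³` on
`τ > 0` with `Q = κ cosh τ / (4 sinh³ τ)`, where `κ` is `K_{2,-}` as a function of `w`. The Pohozaev
function `½ τ v'² - ½ v v' + ¼ τ Q v⁴` has derivative `¼ (3 Q + τ Q') v⁴`, which is negative because
`κ' ≤ 0` and `3 sinh x < x (2 + cosh x)`. It tends to `0` as `τ → 0`, by smoothness at the orbifold
point, and as `τ → ∞`, by smoothness along the zero section, which is absurd.

For `n ≥ 2` the constant `c` is `K_{n,-}` for the function `K_{2,-} = c (n + n s²) / (2 + n s²)`,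
which is then decreasing in `s`.
-/

noncomputable section

open Filter Topology

/-! ### Curvature where the metric is diagonal -/

namespace ChartGeometry

section PartialDerivatives

variable {d : ℕ} {f g : (Fin d → ℝ) → ℝ} {x : Fin d → ℝ}

lemma pd_congr (i : Fin d) (h : f =ᶠ[𝓝 x] g) : pd i f x = pd i g x := by
  rw [pd, pd, h.fderiv_eq]

lemma pd_const (i : Fin d) (c : ℝ) : pd i (fun _ => c) x = 0 := by simp [pd]

lemma pd_add (i : Fin d) (hf : DifferentiableAt ℝ f x) (hg : DifferentiableAt ℝ g x) :
    pd i (fun z => f z + g z) x = pd i f x + pd i g x := by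
  simp [pd, fderiv_fun_add hf hg]

lemma pd_sub (i : Fin d) (hf : DifferentiableAt ℝ f x) (hg : DifferentiableAt ℝ g x) :
    pd i (fun z => f z - g z) x = pd i f x - pd i g x := by
  simp [pd, fderiv_fun_sub hf hg]

lemma pd_mul (i : Fin d) (hf : DifferentiableAt ℝ f x) (hg : DifferentiableAt ℝ g x) :
    pd i (fun z => f z * g z) x = f x * pd i g x + g x * pd i f x := by
  simp [pd, fderiv_fun_mul hf hg]

lemma pd_const_mul (i : Fin d) (c : ℝ) (hf : DifferentiableAt ℝ f x) :
    pd i (fun z => c * f z) x = c * pd i f x := by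
  rw [pd_mul i (differentiableAt_const c) hf, pd_const, mul_zero, add_zero]

lemma pd_sum {ι : Type*} (i : Fin d) {s : Finset ι} {F : ι → (Fin d → ℝ) → ℝ}
    (hF : ∀ j ∈ s, DifferentiableAt ℝ (F j) x) :
    pd i (fun z => ∑ j ∈ s, F j z) x = ∑ j ∈ s, pd i (F j) x := by
  simp [pd, fderiv_fun_sum hF]

lemma differentiableAt_pd (i : Fin d) (hf : ContDiffAt ℝ 2 f x) :
    DifferentiableAt ℝ (pd i f) x := by
  have hfderiv : ContDiffAt ℝ 1 (fderiv ℝ f) x := hf.fderiv_right (by norm_num)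
  exact (hfderiv.differentiableAt one_ne_zero).clm_apply (differentiableAt_const _)

lemma pd_pd_add (i j : Fin d) (hf : ContDiffAt ℝ 2 f x) (hg : ContDiffAt ℝ 2 g x) :
    pd i (pd j fun z => f z + g z) x = pd i (pd j f) x + pd i (pd j g) x := by
  have hpd : (pd j fun z => f z + g z) =ᶠ[𝓝 x] fun z => pd j f z + pd j g z := by
    filter_upwards [hf.eventually (by simp), hg.eventually (by simp)] with z hfz hgz
    exact pd_add j (hfz.differentiableAt two_ne_zero) (hgz.differentiableAt two_ne_zero)
  rw [pd_congr i hpd, pd_add i (differentiableAt_pd j hf) (differentiableAt_pd j hg)]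

lemma deriv_comp_single (hf : Differentiable ℝ f) (i : Fin d) (h : ℝ) :
    deriv (fun h => f (Pi.single i h)) h = pd i f (Pi.single i h) :=
  ((hf _).hasFDerivAt.comp_hasDerivAt h (hasDerivAt_single i h)).deriv

lemma pd_pd_zero_eq_iteratedDeriv (hf : ContDiff ℝ 2 f) (i : Fin d) :
    pd i (pd i f) 0 = iteratedDeriv 2 (fun h => f (Pi.single i h)) 0 := by
  have hpd : Differentiable ℝ (pd i f) := fun x => differentiableAt_pd i hf.contDiffAt
  rw [iteratedDeriv_succ, iteratedDeriv_one,
    funext (deriv_comp_single (hf.differentiable two_ne_zero) i), deriv_comp_single hpd,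
    Pi.single_zero]

end PartialDerivatives

section MatrixCalculus

variable {E : Type*} [NormedAddCommGroup E] [NormedSpace ℝ E] {m : Type*} [Fintype m]
  [DecidableEq m] {M : E → Matrix m m ℝ} {x : E}

lemma differentiableAt_det (hM : ∀ i j, DifferentiableAt ℝ (fun z => M z i j) x) :
    DifferentiableAt ℝ (fun z => (M z).det) x := by
  simp only [Matrix.det_apply]
  exact .fun_sum fun σ _ =>
    (HasFDerivAt.finsetProd fun i _ => (hM (σ i) i).hasFDerivAt).differentiableAt.const_smul _

lemma differentiableAt_inv_apply (hM : ∀ i j, DifferentiableAt ℝ (fun z => M z i j) x)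
    (hdet : (M x).det ≠ 0) (i j : m) : DifferentiableAt ℝ (fun z => (M z)⁻¹ i j) x := by
  simp only [Matrix.inv_def, Matrix.smul_apply, Ring.inverse_eq_inv', Matrix.adjugate_apply,
    smul_eq_mul]
  refine ((differentiableAt_det hM).inv hdet).mul (differentiableAt_det fun k l => ?_)
  simp only [Matrix.updateRow_apply]
  split_ifs
  exacts [differentiableAt_const _, hM k l]

end MatrixCalculus

section Diagonal

/-- The Christoffel symbols of the first kind, `Γₗ;ᵢⱼ = ½ (∂ᵢ gⱼₗ + ∂ⱼ gᵢₗ - ∂ₗ gᵢⱼ)`. Where the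
metric is diagonal the curvature is much shorter in terms of them than in terms of `christoffel`. -/
def christoffelFirst {d : ℕ} (G : (Fin d → ℝ) → Matrix (Fin d) (Fin d) ℝ) (l i j : Fin d)
    (x : Fin d → ℝ) : ℝ :=
  (1 / 2) * (pd i (fun z => G z j l) x + pd j (fun z => G z i l) x - pd l (fun z => G z i j) x)

variable {d : ℕ} {G : (Fin d → ℝ) → Matrix (Fin d) (Fin d) ℝ} {x : Fin d → ℝ} {D : Fin d → ℝ}

lemma christoffel_eq_sum_christoffelFirst (k i j : Fin d) (z : Fin d → ℝ) :
    christoffel G k i j z = ∑ l, (G z)⁻¹ k l * christoffelFirst G l i j z := by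
  simp only [christoffel, christoffelFirst, Finset.mul_sum]
  exact Finset.sum_congr rfl fun l _ => by ring

lemma pd_metric_eq_christoffelFirst_add (hG : ∀ z, (G z).IsSymm) (i k l : Fin d) :
    pd i (fun z => G z k l) x = christoffelFirst G k i l x + christoffelFirst G l i k x := by
  simp only [christoffelFirst, fun z => (hG z).apply k l]
  ring

lemma differentiableAt_christoffelFirst (hG : ∀ i j, ContDiffAt ℝ 2 (fun z => G z i j) x)
    (l i j : Fin d) : DifferentiableAt ℝ (christoffelFirst G l i j) x :=
  (((differentiableAt_pd i (hG j l)).add (differentiableAt_pd j (hG i l))).sub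
    (differentiableAt_pd l (hG i j))).const_mul _

lemma pd_christoffelFirst (hG : ∀ i j, ContDiffAt ℝ 2 (fun z => G z i j) x) (m l i j : Fin d) :
    pd m (christoffelFirst G l i j) x = (1 / 2) * (pd m (pd i fun z => G z j l) x
      + pd m (pd j fun z => G z i l) x - pd m (pd l fun z => G z i j) x) := by
  have hpd := fun a i j => differentiableAt_pd a (hG i j)
  unfold christoffelFirst
  rw [pd_const_mul m _ (((hpd i j l).fun_add (hpd j i l)).fun_sub (hpd l i j)),
    pd_sub m ((hpd i j l).fun_add (hpd j i l)) (hpd l i j), pd_add m (hpd i j l) (hpd j i l)]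

lemma inv_of_eq_diagonal (hD : ∀ i, D i ≠ 0) (hx : G x = Matrix.diagonal D) :
    (G x)⁻¹ = Matrix.diagonal D⁻¹ := by
  rw [hx]
  refine Matrix.inv_eq_right_inv ?_
  simp [Matrix.diagonal_mul_diagonal, mul_inv_cancel₀ (hD _)]

lemma det_ne_zero_of_eq_diagonal (hD : ∀ i, D i ≠ 0) (hx : G x = Matrix.diagonal D) :
    (G x).det ≠ 0 := by
  rw [hx, Matrix.det_diagonal]
  exact Finset.prod_ne_zero_iff.2 fun i _ => hD i

lemma christoffel_of_diagonal (hD : ∀ i, D i ≠ 0) (hx : G x = Matrix.diagonal D) (k i j : Fin d) :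
    christoffel G k i j x = (D k)⁻¹ * christoffelFirst G k i j x := by
  simp [christoffel_eq_sum_christoffelFirst, inv_of_eq_diagonal hD hx, Matrix.diagonal_apply,
    ite_mul]

lemma pd_inv_of_diagonal (hG : ∀ i j, DifferentiableAt ℝ (fun z => G z i j) x)
    (hD : ∀ i, D i ≠ 0) (hx : G x = Matrix.diagonal D) (m k l : Fin d) :
    pd m (fun z => (G z)⁻¹ k l) x = -((D k)⁻¹ * (D l)⁻¹ * pd m (fun z => G z k l) x) := by
  have hdet := det_ne_zero_of_eq_diagonal hD hx
  have hinv := differentiableAt_inv_apply hG hdet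
  have hmul : (fun z => ∑ a, G z k a * (G z)⁻¹ a l)
      =ᶠ[𝓝 x] fun _ => (1 : Matrix (Fin d) (Fin d) ℝ) k l := by
    filter_upwards [(differentiableAt_det hG).continuousAt.eventually_ne hdet] with z hz
    rw [← Matrix.mul_apply, Matrix.mul_nonsing_inv _ (isUnit_iff_ne_zero.2 hz)]
  have hpd := pd_congr m hmul
  rw [pd_const, pd_sum m fun a _ => (hG k a).fun_mul (hinv a l)] at hpd
  simp only [pd_mul m (hG k _) (hinv _ l), inv_of_eq_diagonal hD hx] at hpd
  simp only [hx, Matrix.diagonal_apply, Pi.inv_apply, ite_mul, zero_mul, Finset.sum_add_distrib,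
    Finset.sum_ite_eq, Finset.sum_ite_eq', Finset.mem_univ, if_true] at hpd
  have := hD k
  field_simp
  linear_combination hpd

lemma pd_christoffel_of_diagonal (hG : ∀ i j, ContDiffAt ℝ 2 (fun z => G z i j) x)
    (hD : ∀ i, D i ≠ 0) (hx : G x = Matrix.diagonal D) (m k i j : Fin d) :
    pd m (christoffel G k i j) x = (D k)⁻¹ * pd m (christoffelFirst G k i j) x
      - ∑ l, (D k)⁻¹ * (D l)⁻¹ * pd m (fun z => G z k l) x * christoffelFirst G l i j x := by
  have hG' := fun i j => (hG i j).differentiableAt two_ne_zero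
  have hinv := differentiableAt_inv_apply hG' (det_ne_zero_of_eq_diagonal hD hx)
  have hΓ := differentiableAt_christoffelFirst hG
  rw [funext (christoffel_eq_sum_christoffelFirst k i j),
    pd_sum m fun l _ => (hinv k l).fun_mul (hΓ l i j)]
  simp only [pd_mul m (hinv k _) (hΓ _ i j), pd_inv_of_diagonal hG' hD hx,
    inv_of_eq_diagonal hD hx, Matrix.diagonal_apply, Pi.inv_apply, ite_mul, zero_mul,
    Finset.sum_add_distrib, Finset.sum_ite_eq, Finset.mem_univ, if_true,
    mul_comm (christoffelFirst G _ i j x), neg_mul, Finset.sum_neg_distrib, sub_eq_add_neg]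

theorem laplacian_of_diagonal (hD : ∀ i, D i ≠ 0) (hx : G x = Matrix.diagonal D)
    (f : (Fin d → ℝ) → ℝ) :
    laplacian G f x = ∑ i, (D i)⁻¹ * (pd i (pd i f) x
      - ∑ k, (D k)⁻¹ * christoffelFirst G k i i x * pd k f x) := by
  simp [laplacian, inv_of_eq_diagonal hD hx, Matrix.diagonal_apply, ite_mul,
    christoffel_of_diagonal hD hx]

lemma ricci_self_of_diagonal (hG : ∀ i j, ContDiffAt ℝ 2 (fun z => G z i j) x)
    (hsymm : ∀ z, (G z).IsSymm) (hD : ∀ i, D i ≠ 0) (hx : G x = Matrix.diagonal D) (i : Fin d) :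
    ricci G i i x = ∑ k, (D k)⁻¹ * (pd k (pd i fun z => G z i k) x
        - (1 / 2) * pd k (pd k fun z => G z i i) x - (1 / 2) * pd i (pd i fun z => G z k k) x)
      + ∑ k, ∑ l, (D k)⁻¹ * (D l)⁻¹ * (christoffelFirst G l i k x ^ 2
        - christoffelFirst G l i i x * christoffelFirst G l k k x) := by
  simp only [ricci, ← Finset.sum_add_distrib]
  refine Finset.sum_congr rfl fun k _ => ?_
  have hquad : ∀ l, (D k)⁻¹ * (D l)⁻¹ * (christoffelFirst G l i k x ^ 2
        - christoffelFirst G l i i x * christoffelFirst G l k k x)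
      = (D k)⁻¹ * (D l)⁻¹ * pd i (fun z => G z k l) x * christoffelFirst G l i k x
        - (D k)⁻¹ * (D l)⁻¹ * pd k (fun z => G z k l) x * christoffelFirst G l i i x
        + (christoffel G k k l x * christoffel G l i i x
          - christoffel G k i l x * christoffel G l i k x) := fun l => by
    simp only [christoffel_of_diagonal hD hx, pd_metric_eq_christoffelFirst_add hsymm]
    ring
  rw [pd_christoffel_of_diagonal hG hD hx, pd_christoffel_of_diagonal hG hD hx,
    pd_christoffelFirst hG, pd_christoffelFirst hG, Finset.sum_congr rfl fun l _ => hquad l]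
  simp only [Finset.sum_add_distrib, Finset.sum_sub_distrib]
  ring

theorem scalarCurvature_of_diagonal (hG : ∀ i j, ContDiffAt ℝ 2 (fun z => G z i j) x)
    (hsymm : ∀ z, (G z).IsSymm) (hD : ∀ i, D i ≠ 0) (hx : G x = Matrix.diagonal D) :
    scalarCurvature G x
      = ∑ i, ∑ k, (D i)⁻¹ * (D k)⁻¹
          * (pd k (pd i fun z => G z i k) x - pd k (pd k fun z => G z i i) x)
        + ∑ i, ∑ k, ∑ l, (D i)⁻¹ * (D k)⁻¹ * (D l)⁻¹ * (christoffelFirst G l i k x ^ 2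
          - christoffelFirst G l i i x * christoffelFirst G l k k x) := by
  have htrace : scalarCurvature G x = ∑ i, (D i)⁻¹ * ricci G i i x := by
    simp [scalarCurvature, inv_of_eq_diagonal hD hx, Matrix.diagonal_apply, ite_mul]
  have hcomm : ∑ i, ∑ k, (D i)⁻¹ * (D k)⁻¹ * pd i (pd i fun z => G z k k) x
      = ∑ i, ∑ k, (D i)⁻¹ * (D k)⁻¹ * pd k (pd k fun z => G z i i) x := by
    rw [Finset.sum_comm]
    exact Finset.sum_congr rfl fun i _ => Finset.sum_congr rfl fun k _ => by
      rw [mul_comm (D k)⁻¹]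
  simp only [htrace, ricci_self_of_diagonal hG hsymm hD hx, mul_add, Finset.mul_sum,
    Finset.sum_add_distrib, ← mul_assoc, mul_sub, Finset.sum_sub_distrib,
    mul_left_comm _ (1 / 2 : ℝ)]
  simp only [mul_assoc (1 / 2 : ℝ), ← Finset.mul_sum, hcomm]
  ring

end Diagonal

section Radial

variable {d : ℕ} {φ : ℝ → ℝ} {h : (Fin d → ℝ) → ℝ} {x : Fin d → ℝ}

/-- The squared Euclidean norm; the norm of `Fin d → ℝ` is the supremum norm. -/
def normSq {d : ℕ} (z : Fin d → ℝ) : ℝ := z ⬝ᵥ z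

lemma normSq_nonneg (x : Fin d → ℝ) : 0 ≤ normSq x :=
  dotProduct_self_star_nonneg x

lemma contDiff_normSq {n : WithTop ℕ∞} : ContDiff ℝ n (normSq (d := d)) := by
  unfold normSq dotProduct
  fun_prop

lemma differentiableAt_comp_normSq (hφ : DifferentiableAt ℝ φ (normSq x)) :
    DifferentiableAt ℝ (fun z => φ (normSq z)) x :=
  hφ.comp x (contDiff_normSq.differentiable one_ne_zero x)

lemma contDiffAt_comp_normSq {n : WithTop ℕ∞} (hφ : ContDiffAt ℝ n φ (normSq x)) :
    ContDiffAt ℝ n (fun z => φ (normSq z)) x :=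
  hφ.comp x contDiff_normSq.contDiffAt

lemma pd_apply (m i : Fin d) : pd m (fun z => z i) x = (Pi.single m 1 : Fin d → ℝ) i := by
  simp [pd, fderiv_apply]

lemma pd_mulVec (m : Fin d) (M : Matrix (Fin d) (Fin d) ℝ) (i : Fin d) :
    pd m (fun z => (M.mulVec z) i) x = M i m := by
  simp only [Matrix.mulVec, dotProduct]
  rw [pd_sum m fun j _ => (differentiableAt_apply j x).const_mul _]
  simp [pd_const_mul m _ (differentiableAt_apply _ x), pd_apply, Pi.single_apply]

lemma pd_normSq (m : Fin d) : pd m normSq x = 2 * x m := by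
  have hcoord := fun i => differentiableAt_apply (𝕜 := ℝ) i x
  unfold normSq dotProduct
  rw [pd_sum m fun j _ => (hcoord j).fun_mul (hcoord j)]
  simp [pd_mul m (hcoord _) (hcoord _), pd_apply, Pi.single_apply, Finset.sum_add_distrib, two_mul]

lemma pd_comp_normSq (m : Fin d) (hφ : DifferentiableAt ℝ φ (normSq x)) :
    pd m (fun z => φ (normSq z)) x = 2 * x m * deriv φ (normSq x) := by
  have hcomp : HasFDerivAt (fun z => φ (normSq z)) _ x := hφ.hasDerivAt.comp_hasFDerivAt x
    (contDiff_normSq.differentiable one_ne_zero x).hasFDerivAt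
  rw [pd, hcomp.fderiv, smul_apply, ← pd, pd_normSq, smul_eq_mul, mul_comm]

lemma pd_radial_mul (m : Fin d) (hφ : DifferentiableAt ℝ φ (normSq x))
    (hh : DifferentiableAt ℝ h x) :
    pd m (fun z => φ (normSq z) * h z) x
      = 2 * x m * deriv φ (normSq x) * h x + φ (normSq x) * pd m h x := by
  rw [pd_mul m (differentiableAt_comp_normSq hφ) hh, pd_comp_normSq m hφ]
  ring

lemma pd_pd_radial_mul (l m : Fin d) (hφ : ContDiffAt ℝ 2 φ (normSq x)) (hh : ContDiffAt ℝ 2 h x) :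
    pd l (pd m fun z => φ (normSq z) * h z) x
      = (4 * x l * x m * deriv (deriv φ) (normSq x)
          + 2 * (Pi.single l 1 : Fin d → ℝ) m * deriv φ (normSq x)) * h x
        + 2 * deriv φ (normSq x) * (x l * pd m h x + x m * pd l h x)
        + φ (normSq x) * pd l (pd m h) x := by
  have hφ_near : ∀ᶠ z in 𝓝 x, DifferentiableAt ℝ φ (normSq z) :=
    (contDiff_normSq (n := 0)).continuous.continuousAt.eventually
      ((hφ.eventually (by simp)).mono fun _ hw => hw.differentiableAt two_ne_zero)
  have hh_near : ∀ᶠ z in 𝓝 x, DifferentiableAt ℝ h z :=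
    (hh.eventually (by simp)).mono fun _ hz => hz.differentiableAt two_ne_zero
  have hfirst : (pd m fun z => φ (normSq z) * h z)
      =ᶠ[𝓝 x] fun z => 2 * (deriv φ (normSq z) * (z m * h z)) + φ (normSq z) * pd m h z := by
    filter_upwards [hφ_near, hh_near] with z hφz hhz
    rw [pd_radial_mul m hφz hhz]
    ring
  have hφ₁ : DifferentiableAt ℝ φ (normSq x) := hφ.differentiableAt two_ne_zero
  have hφ₂ : DifferentiableAt ℝ (deriv φ) (normSq x) :=
    (hφ.derivWithin (m := 1) (by norm_num)).differentiableAt one_ne_zero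
  have hh₁ : DifferentiableAt ℝ h x := hh.differentiableAt two_ne_zero
  have hcoord : DifferentiableAt ℝ (fun z : Fin d → ℝ => z m * h z) x :=
    (differentiableAt_apply m x).fun_mul hh₁
  rw [pd_congr l hfirst, pd_add l (((differentiableAt_comp_normSq hφ₂).fun_mul hcoord).const_mul 2)
      ((differentiableAt_comp_normSq hφ₁).fun_mul (differentiableAt_pd m hh)),
    pd_const_mul l 2 ((differentiableAt_comp_normSq hφ₂).fun_mul hcoord),
    pd_radial_mul l hφ₂ hcoord, pd_radial_mul l hφ₁ (differentiableAt_pd m hh),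
    pd_mul l (differentiableAt_apply m x) hh₁, pd_apply]
  ring

lemma pd_pd_comp_normSq (l m : Fin d) (hφ : ContDiffAt ℝ 2 φ (normSq x)) :
    pd l (pd m fun z => φ (normSq z)) x
      = 4 * x l * x m * deriv (deriv φ) (normSq x)
        + 2 * (Pi.single l 1 : Fin d → ℝ) m * deriv φ (normSq x) := by
  have hpd := pd_pd_radial_mul l m hφ (contDiffAt_const (c := (1 : ℝ)))
  simpa [pd_const, funext fun z => pd_const (x := z) m (1 : ℝ)] using hpd

end Radial

section RadialMetric

variable {d : ℕ}

/-- The metric `α |dx|² + β (∑ xᵢ dxᵢ)² + γ (∑ (Jx)ᵢ dxᵢ)²` with coefficients depending on `|x|²`.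
When `J` is the complex structure of `ℂᵐ` it is invariant under `U(m)`. -/
def radialMetric (J : Matrix (Fin d) (Fin d) ℝ) (α β γ : ℝ → ℝ) (x : Fin d → ℝ) :
    Matrix (Fin d) (Fin d) ℝ :=
  α (normSq x) • 1 + β (normSq x) • Matrix.vecMulVec x x
    + γ (normSq x) • Matrix.vecMulVec (J.mulVec x) (J.mulVec x)

variable {J M : Matrix (Fin d) (Fin d) ℝ} {φ α β γ : ℝ → ℝ} {x : Fin d → ℝ}

lemma isSymm_radialMetric (x : Fin d → ℝ) : (radialMetric J α β γ x).IsSymm := by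
  ext i j
  simp [radialMetric, Matrix.one_apply, Matrix.vecMulVec_apply, mul_comm, eq_comm]

lemma radialMetric_apply (i j : Fin d) (z : Fin d → ℝ) :
    radialMetric J α β γ z i j = α (normSq z) * (1 : Matrix (Fin d) (Fin d) ℝ) i j
      + β (normSq z) * (Matrix.mulVec 1 z i * Matrix.mulVec 1 z j)
      + γ (normSq z) * (J.mulVec z i * J.mulVec z j) := by
  simp [radialMetric, Matrix.vecMulVec_apply]

lemma contDiff_mulVec_apply {n : WithTop ℕ∞} (i : Fin d) : ContDiff ℝ n fun z => M.mulVec z i := by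
  simp only [Matrix.mulVec, dotProduct]
  fun_prop

lemma pd_mulVec_mul_mulVec (m i j : Fin d) :
    pd m (fun z => M.mulVec z i * M.mulVec z j) x
      = M i m * M.mulVec x j + M.mulVec x i * M j m := by
  have hM := fun i => (contDiff_mulVec_apply (M := M) i).differentiable one_ne_zero x
  rw [pd_mul m (hM i) (hM j), pd_mulVec, pd_mulVec]
  ring

lemma pd_pd_mulVec_mul_mulVec (l m i j : Fin d) :
    pd l (pd m fun z => M.mulVec z i * M.mulVec z j) x = M i m * M j l + M i l * M j m := by
  have hM := fun i => (contDiff_mulVec_apply (M := M) i).differentiable one_ne_zero x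
  have hpd : (pd m fun z => M.mulVec z i * M.mulVec z j)
      = fun z => M i m * M.mulVec z j + M j m * M.mulVec z i :=
    funext fun z => by rw [pd_mulVec_mul_mulVec, mul_comm (M.mulVec z i)]
  rw [hpd, pd_add l ((hM j).const_mul _) ((hM i).const_mul _), pd_const_mul l _ (hM j),
    pd_const_mul l _ (hM i), pd_mulVec, pd_mulVec]
  ring

lemma contDiffAt_radial_mul_mulVec (hφ : ContDiffAt ℝ 2 φ (normSq x)) (i j : Fin d) :
    ContDiffAt ℝ 2 (fun z => φ (normSq z) * (M.mulVec z i * M.mulVec z j)) x :=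
  (contDiffAt_comp_normSq hφ).mul
    ((contDiff_mulVec_apply i).mul (contDiff_mulVec_apply j)).contDiffAt

lemma pd_radial_mul_mulVec (hφ : ContDiffAt ℝ 2 φ (normSq x)) (m i j : Fin d) :
    pd m (fun z => φ (normSq z) * (M.mulVec z i * M.mulVec z j)) x
      = 2 * x m * deriv φ (normSq x) * (M.mulVec x i * M.mulVec x j)
        + φ (normSq x) * (M i m * M.mulVec x j + M.mulVec x i * M j m) := by
  rw [pd_radial_mul m (hφ.differentiableAt two_ne_zero)
    (((contDiff_mulVec_apply i).mul (contDiff_mulVec_apply j)).differentiable one_ne_zero x),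
    pd_mulVec_mul_mulVec]

lemma pd_pd_radial_mul_mulVec (hφ : ContDiffAt ℝ 2 φ (normSq x)) (l m i j : Fin d) :
    pd l (pd m fun z => φ (normSq z) * (M.mulVec z i * M.mulVec z j)) x
      = (4 * x l * x m * deriv (deriv φ) (normSq x)
          + 2 * (Pi.single l 1 : Fin d → ℝ) m * deriv φ (normSq x)) * (M.mulVec x i * M.mulVec x j)
        + 2 * deriv φ (normSq x) * (x l * (M i m * M.mulVec x j + M.mulVec x i * M j m)
          + x m * (M i l * M.mulVec x j + M.mulVec x i * M j l))
        + φ (normSq x) * (M i m * M j l + M i l * M j m) := by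
  rw [pd_pd_radial_mul l m hφ
    ((contDiff_mulVec_apply i).mul (contDiff_mulVec_apply j)).contDiffAt,
    pd_mulVec_mul_mulVec, pd_mulVec_mul_mulVec, pd_pd_mulVec_mul_mulVec]

lemma contDiffAt_radialMetric (hα : ContDiffAt ℝ 2 α (normSq x)) (hβ : ContDiffAt ℝ 2 β (normSq x))
    (hγ : ContDiffAt ℝ 2 γ (normSq x)) (i j : Fin d) :
    ContDiffAt ℝ 2 (fun z => radialMetric J α β γ z i j) x := by
  simp only [radialMetric_apply]
  exact (((contDiffAt_comp_normSq hα).mul contDiffAt_const).add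
    (contDiffAt_radial_mul_mulVec hβ i j)).add (contDiffAt_radial_mul_mulVec hγ i j)

lemma pd_radialMetric (hα : ContDiffAt ℝ 2 α (normSq x)) (hβ : ContDiffAt ℝ 2 β (normSq x))
    (hγ : ContDiffAt ℝ 2 γ (normSq x)) (m i j : Fin d) :
    pd m (fun z => radialMetric J α β γ z i j) x
      = 2 * x m * (deriv α (normSq x) * (1 : Matrix (Fin d) (Fin d) ℝ) i j
          + deriv β (normSq x) * (x i * x j)
          + deriv γ (normSq x) * (J.mulVec x i * J.mulVec x j))
        + β (normSq x) * ((1 : Matrix (Fin d) (Fin d) ℝ) i m * x j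
          + x i * (1 : Matrix (Fin d) (Fin d) ℝ) j m)
        + γ (normSq x) * (J i m * J.mulVec x j + J.mulVec x i * J j m) := by
  have hα₁ := (contDiffAt_comp_normSq hα).mul
    (contDiffAt_const (c := (1 : Matrix (Fin d) (Fin d) ℝ) i j))
  have hβ₁ := contDiffAt_radial_mul_mulVec (M := 1) hβ i j
  have hγ₁ := contDiffAt_radial_mul_mulVec (M := J) hγ i j
  simp only [radialMetric_apply]
  rw [pd_add m ((hα₁.add hβ₁).differentiableAt two_ne_zero) (hγ₁.differentiableAt two_ne_zero),
    pd_add m (hα₁.differentiableAt two_ne_zero) (hβ₁.differentiableAt two_ne_zero),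
    pd_radial_mul m (hα.differentiableAt two_ne_zero) (differentiableAt_const _), pd_const,
    pd_radial_mul_mulVec hβ, pd_radial_mul_mulVec hγ]
  simp only [Matrix.one_mulVec]
  ring

lemma pd_pd_radialMetric (hα : ContDiffAt ℝ 2 α (normSq x)) (hβ : ContDiffAt ℝ 2 β (normSq x))
    (hγ : ContDiffAt ℝ 2 γ (normSq x)) (l m i j : Fin d) :
    pd l (pd m fun z => radialMetric J α β γ z i j) x
      = pd l (pd m fun z => α (normSq z) * (1 : Matrix (Fin d) (Fin d) ℝ) i j) x
        + pd l (pd m fun z => β (normSq z) * (Matrix.mulVec 1 z i * Matrix.mulVec 1 z j)) x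
        + pd l (pd m fun z => γ (normSq z) * (J.mulVec z i * J.mulVec z j)) x := by
  have hα₁ := (contDiffAt_comp_normSq hα).mul
    (contDiffAt_const (c := (1 : Matrix (Fin d) (Fin d) ℝ) i j))
  have hβ₁ := contDiffAt_radial_mul_mulVec (M := 1) hβ i j
  have hγ₁ := contDiffAt_radial_mul_mulVec (M := J) hγ i j
  simp only [radialMetric_apply]
  rw [pd_pd_add l m (hα₁.add hβ₁) hγ₁, pd_pd_add l m hα₁ hβ₁]

end RadialMetric

section Axis

/-- The complex structure of `ℂ² = ℝ⁴`, with `(x₀ + i x₁, x₂ + i x₃)` as coordinates. -/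
def complexStructure : Matrix (Fin 4) (Fin 4) ℝ :=
  !![0, -1, 0, 0; 1, 0, 0, 0; 0, 0, 0, -1; 0, 0, 1, 0]

/-- The eigenvalue of `radialMetric _ α β γ` at `|x|² = w` in the direction of `x`; with `γ` in
place of `β`, the one in the direction of `Jx`. -/
def eigenvalue (α β : ℝ → ℝ) (w : ℝ) : ℝ := α w + w * β w

variable {α β γ φ : ℝ → ℝ} {t : ℝ}

lemma normSq_axis (t : ℝ) : normSq ![t, 0, 0, 0] = t ^ 2 := by
  simp [normSq, sq]

lemma complexStructure_mulVec_axis (t : ℝ) :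
    complexStructure.mulVec ![t, 0, 0, 0] = ![0, t, 0, 0] := by
  ext i
  fin_cases i <;> simp [complexStructure, Matrix.mulVec, Matrix.vecHead]

lemma radialMetric_axis (t : ℝ) :
    radialMetric complexStructure α β γ ![t, 0, 0, 0]
      = Matrix.diagonal
          ![eigenvalue α β (t ^ 2), eigenvalue α γ (t ^ 2), α (t ^ 2), α (t ^ 2)] := by
  ext i j
  fin_cases i <;> fin_cases j <;>
    simp [radialMetric, normSq_axis, complexStructure_mulVec_axis, eigenvalue] <;> ring

lemma hasDerivAt_eigenvalue {w : ℝ} (hα : DifferentiableAt ℝ α w) (hβ : DifferentiableAt ℝ β w) :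
    HasDerivAt (eigenvalue α β) (deriv α w + (β w + w * deriv β w)) w := by
  simpa using! hα.hasDerivAt.add ((hasDerivAt_id w).mul hβ.hasDerivAt)

lemma deriv_deriv_eigenvalue {w : ℝ} (hα : ContDiffAt ℝ 2 α w) (hβ : ContDiffAt ℝ 2 β w) :
    deriv (deriv (eigenvalue α β)) w
      = deriv (deriv α) w + (2 * deriv β w + w * deriv (deriv β) w) := by
  have hderiv : deriv (eigenvalue α β) =ᶠ[𝓝 w] fun v => deriv α v + (β v + v * deriv β v) := by
    filter_upwards [hα.eventually (by simp), hβ.eventually (by simp)] with v hαv hβv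
    exact (hasDerivAt_eigenvalue (hαv.differentiableAt two_ne_zero)
      (hβv.differentiableAt two_ne_zero)).deriv
  have hα₂ := ((hα.derivWithin (m := 1) (by norm_num)).differentiableAt one_ne_zero).hasDerivAt
  have hβ₂ := ((hβ.derivWithin (m := 1) (by norm_num)).differentiableAt one_ne_zero).hasDerivAt
  rw [hderiv.deriv_eq]
  refine (hα₂.fun_add ((hβ.differentiableAt two_ne_zero).hasDerivAt.fun_add
    ((hasDerivAt_id' w).fun_mul hβ₂))).deriv.trans ?_
  ring

lemma christoffelFirst_radialMetric_axis (hα : ContDiffAt ℝ 2 α (t ^ 2))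
    (hβ : ContDiffAt ℝ 2 β (t ^ 2)) (hγ : ContDiffAt ℝ 2 γ (t ^ 2)) (l i j : Fin 4) :
    christoffelFirst (radialMetric complexStructure α β γ) l i j ![t, 0, 0, 0]
      = t * (![!![deriv (eigenvalue α β) (t ^ 2), 0, 0, 0;
            0, β (t ^ 2) - γ (t ^ 2) - deriv (eigenvalue α γ) (t ^ 2), 0, 0;
            0, 0, β (t ^ 2) - deriv α (t ^ 2), 0;
            0, 0, 0, β (t ^ 2) - deriv α (t ^ 2)],
          !![0, deriv (eigenvalue α γ) (t ^ 2), 0, 0;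
            deriv (eigenvalue α γ) (t ^ 2), 0, 0, 0; 0, 0, 0, 0; 0, 0, 0, 0],
          !![0, 0, deriv α (t ^ 2), 0; 0, 0, 0, -γ (t ^ 2);
            deriv α (t ^ 2), 0, 0, 0; 0, -γ (t ^ 2), 0, 0],
          !![0, 0, 0, deriv α (t ^ 2); 0, 0, γ (t ^ 2), 0;
            0, γ (t ^ 2), 0, 0; deriv α (t ^ 2), 0, 0, 0]] l i j) := by
  rw [← normSq_axis] at hα hβ hγ
  have hpd := fun m i j => pd_radialMetric (J := complexStructure) hα hβ hγ m i j
  have hP := (hasDerivAt_eigenvalue (hα.differentiableAt two_ne_zero)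
    (hβ.differentiableAt two_ne_zero)).deriv
  have hQ := (hasDerivAt_eigenvalue (hα.differentiableAt two_ne_zero)
    (hγ.differentiableAt two_ne_zero)).deriv
  simp only [normSq_axis, complexStructure_mulVec_axis] at hpd hP hQ
  simp only [christoffelFirst, hpd, hP, hQ]
  fin_cases l <;> fin_cases i <;> fin_cases j <;> simp [complexStructure] <;> ring

theorem laplacian_radialMetric_axis (hα : ContDiffAt ℝ 2 α (t ^ 2))
    (hβ : ContDiffAt ℝ 2 β (t ^ 2)) (hγ : ContDiffAt ℝ 2 γ (t ^ 2))
    (hφ : ContDiffAt ℝ 2 φ (t ^ 2)) (hA : α (t ^ 2) ≠ 0) (hP : eigenvalue α β (t ^ 2) ≠ 0)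
    (hQ : eigenvalue α γ (t ^ 2) ≠ 0) :
    laplacian (radialMetric complexStructure α β γ) (fun z => φ (normSq z)) ![t, 0, 0, 0]
      = (4 * t ^ 2 * deriv (deriv φ) (t ^ 2) + 8 * deriv φ (t ^ 2)
        + 2 * t ^ 2 * (2 * logDeriv α (t ^ 2) + logDeriv (eigenvalue α γ) (t ^ 2)
          - logDeriv (eigenvalue α β) (t ^ 2)) * deriv φ (t ^ 2)) / eigenvalue α β (t ^ 2) := by
  rw [← normSq_axis] at hφ
  have hpd := fun i => pd_comp_normSq i (hφ.differentiableAt two_ne_zero)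
  have hpdpd := fun i => pd_pd_comp_normSq i i hφ
  have hD : ∀ i, ![eigenvalue α β (t ^ 2), eigenvalue α γ (t ^ 2), α (t ^ 2), α (t ^ 2)] i ≠ 0 := by
    intro i
    fin_cases i <;> assumption
  rw [laplacian_of_diagonal hD (radialMetric_axis t)]
  simp only [christoffelFirst_radialMetric_axis hα hβ hγ, hpd, hpdpd, normSq_axis,
    Fin.sum_univ_four, logDeriv_apply]
  simp only [Matrix.cons_val_zero, Pi.single_eq_same, mul_one, Matrix.of_apply, Matrix.cons_val',
    Matrix.cons_val_fin_one, Matrix.cons_val_one, mul_zero, zero_mul, add_zero, Matrix.cons_val,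
    zero_add]
  unfold eigenvalue at hP hQ ⊢
  field_simp
  ring

lemma pd_pd_sub_pd_pd_radialMetric_axis (hα : ContDiffAt ℝ 2 α (t ^ 2))
    (hβ : ContDiffAt ℝ 2 β (t ^ 2)) (hγ : ContDiffAt ℝ 2 γ (t ^ 2)) (i k : Fin 4) :
    pd k (pd i fun z => radialMetric complexStructure α β γ z i k) ![t, 0, 0, 0]
        - pd k (pd k fun z => radialMetric complexStructure α β γ z i i) ![t, 0, 0, 0]
      = !![0, -2 * deriv α (t ^ 2) - 3 * γ (t ^ 2) - 2 * t ^ 2 * deriv γ (t ^ 2),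
            -2 * deriv α (t ^ 2), -2 * deriv α (t ^ 2);
          2 * t ^ 2 * (deriv β (t ^ 2) - deriv γ (t ^ 2)) - γ (t ^ 2)
              - 4 * t ^ 2 * deriv (deriv (eigenvalue α γ)) (t ^ 2)
              - 2 * deriv (eigenvalue α γ) (t ^ 2),
            0, -2 * deriv α (t ^ 2) - 2 * t ^ 2 * deriv γ (t ^ 2),
            -2 * deriv α (t ^ 2) - 2 * t ^ 2 * deriv γ (t ^ 2);
          2 * t ^ 2 * deriv β (t ^ 2) - 4 * t ^ 2 * deriv (deriv α) (t ^ 2) - 2 * deriv α (t ^ 2),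
            -2 * deriv α (t ^ 2), 0, -2 * deriv α (t ^ 2) - 3 * γ (t ^ 2);
          2 * t ^ 2 * deriv β (t ^ 2) - 4 * t ^ 2 * deriv (deriv α) (t ^ 2) - 2 * deriv α (t ^ 2),
            -2 * deriv α (t ^ 2), -2 * deriv α (t ^ 2) - 3 * γ (t ^ 2), 0] i k
        + if i = k then 0 else β (t ^ 2) := by
  have hQ := (hasDerivAt_eigenvalue (hα.differentiableAt two_ne_zero)
    (hγ.differentiableAt two_ne_zero)).deriv
  have hQ₂ := deriv_deriv_eigenvalue hα hγ
  rw [← normSq_axis] at hα hβ hγ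
  have hpd := fun l m i j => pd_pd_radialMetric (J := complexStructure) hα hβ hγ l m i j
  have hα₁ := fun l m i j => pd_pd_radial_mul l m hα
    (contDiffAt_const (c := (1 : Matrix (Fin 4) (Fin 4) ℝ) i j))
  have hconst := fun m (c : ℝ) => funext fun z : Fin 4 → ℝ => pd_const (x := z) m c
  simp only [hpd, hα₁, pd_pd_radial_mul_mulVec hβ, pd_pd_radial_mul_mulVec hγ]
  simp only [normSq_axis, complexStructure_mulVec_axis, Matrix.one_mulVec, hconst, hQ, hQ₂]
  fin_cases i <;> fin_cases k <;> simp [complexStructure] <;> ring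

theorem scalarCurvature_radialMetric_axis (hα : ContDiffAt ℝ 2 α (t ^ 2))
    (hβ : ContDiffAt ℝ 2 β (t ^ 2)) (hγ : ContDiffAt ℝ 2 γ (t ^ 2)) (ht : t ≠ 0)
    (hA : α (t ^ 2) ≠ 0) (hP : eigenvalue α β (t ^ 2) ≠ 0) (hQ : eigenvalue α γ (t ^ 2) ≠ 0) :
    scalarCurvature (radialMetric complexStructure α β γ) ![t, 0, 0, 0]
      = (-6 / t ^ 2 - 20 * logDeriv α (t ^ 2) - 10 * logDeriv (eigenvalue α γ) (t ^ 2)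
        - 8 * t ^ 2 * deriv (deriv α) (t ^ 2) / α (t ^ 2)
        - 4 * t ^ 2 * deriv (deriv (eigenvalue α γ)) (t ^ 2) / eigenvalue α γ (t ^ 2)
        + 2 * t ^ 2 * (logDeriv α (t ^ 2) - logDeriv (eigenvalue α γ) (t ^ 2)) ^ 2
        + (6 + 4 * t ^ 2 * logDeriv α (t ^ 2) + 2 * t ^ 2 * logDeriv (eigenvalue α γ) (t ^ 2))
          * logDeriv (eigenvalue α β) (t ^ 2)
        + eigenvalue α β (t ^ 2) / t ^ 2 *
          (8 / α (t ^ 2) - 2 * eigenvalue α γ (t ^ 2) / α (t ^ 2) ^ 2))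
        / eigenvalue α β (t ^ 2) := by
  have hD : ∀ i, ![eigenvalue α β (t ^ 2), eigenvalue α γ (t ^ 2), α (t ^ 2), α (t ^ 2)] i ≠ 0 := by
    intro i
    fin_cases i <;> assumption
  have hG := contDiffAt_radialMetric (J := complexStructure) ((normSq_axis t).symm ▸ hα)
    ((normSq_axis t).symm ▸ hβ) ((normSq_axis t).symm ▸ hγ)
  rw [scalarCurvature_of_diagonal hG isSymm_radialMetric hD (radialMetric_axis t)]
  simp only [christoffelFirst_radialMetric_axis hα hβ hγ,
    pd_pd_sub_pd_pd_radialMetric_axis hα hβ hγ, Fin.sum_univ_four, logDeriv_apply]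
  have hdP := (hasDerivAt_eigenvalue (hα.differentiableAt two_ne_zero)
    (hβ.differentiableAt two_ne_zero)).deriv
  have hdQ := (hasDerivAt_eigenvalue (hα.differentiableAt two_ne_zero)
    (hγ.differentiableAt two_ne_zero)).deriv
  simp only [Matrix.cons_val_zero, Matrix.of_apply, Matrix.cons_val', Matrix.cons_val_fin_one,
    ↓reduceIte, add_zero, mul_zero, Matrix.cons_val_one, zero_ne_one, zero_add, Matrix.cons_val,
    Fin.reduceEq, one_ne_zero]
  simp only [hdP, hdQ, deriv_deriv_eigenvalue hα hγ]
  unfold eigenvalue at hP hQ ⊢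
  field_simp
  ring

end Axis

end ChartGeometry

/-! ### The Emden-Fowler transform -/

namespace EmdenFowler

lemma pos_of_hasDerivAt_pos {f f' : ℝ → ℝ} (hf : ∀ x, HasDerivAt f (f' x) x) (h0 : f 0 = 0)
    (hf' : ∀ x, 0 < x → 0 < f' x) {x : ℝ} (hx : 0 < x) : 0 < f x := by
  have hmono : StrictMonoOn f (Set.Ici 0) :=
    strictMonoOn_of_hasDerivWithinAt_pos (convex_Ici 0)
      (fun y _ => (hf y).continuousAt.continuousWithinAt) (fun y _ => (hf y).hasDerivWithinAt)
      fun y hy => hf' y (by simpa using hy)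
  exact h0 ▸ hmono Set.self_mem_Ici hx.le hx

lemma sinh_lt_mul_cosh {x : ℝ} (hx : 0 < x) : Real.sinh x < x * Real.cosh x := by
  rw [← sub_pos]
  refine pos_of_hasDerivAt_pos (f := fun x => x * Real.cosh x - Real.sinh x)
    (f' := fun x => x * Real.sinh x) (fun y => ?_) (by simp)
    (fun y hy => mul_pos hy (Real.sinh_pos_iff.2 hy)) hx
  exact (((hasDerivAt_id' y).fun_mul (Real.hasDerivAt_cosh y)).fun_sub
    (Real.hasDerivAt_sinh y)).congr_deriv (by ring)

lemma three_mul_sinh_lt_mul_two_add_cosh {x : ℝ} (hx : 0 < x) :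
    3 * Real.sinh x < x * (2 + Real.cosh x) := by
  have hderiv : ∀ y, 0 < y → 0 < 2 + y * Real.sinh y - 2 * Real.cosh y := fun y hy => by
    refine pos_of_hasDerivAt_pos (f := fun y => 2 + y * Real.sinh y - 2 * Real.cosh y)
      (f' := fun y => y * Real.cosh y - Real.sinh y) (fun z => ?_) (by simp)
      (fun z hz => sub_pos.2 (sinh_lt_mul_cosh hz)) hy
    exact ((((hasDerivAt_id' z).fun_mul (Real.hasDerivAt_sinh z)).const_add 2).fun_sub
      ((Real.hasDerivAt_cosh z).const_mul 2)).congr_deriv (by ring)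
  rw [← sub_pos]
  refine pos_of_hasDerivAt_pos (f := fun x => x * (2 + Real.cosh x) - 3 * Real.sinh x)
    (fun y => ?_) (by simp) hderiv hx
  exact (((hasDerivAt_id' y).fun_mul ((Real.hasDerivAt_cosh y).const_add 2)).fun_sub
    ((Real.hasDerivAt_sinh y).const_mul 3)).congr_deriv (by ring)

lemma lt_of_strictAntiOn_of_tendsto {f : ℝ → ℝ} {a l m : ℝ} (hf : StrictAntiOn f (Set.Ioi a))
    (hl : Tendsto f (𝓝[>] a) (𝓝 l)) (hm : Tendsto f atTop (𝓝 m)) : m < l := by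
  have h₁ : a + 1 ∈ Set.Ioi a := lt_add_one a
  have h₂ : a + 2 ∈ Set.Ioi a := lt_add_of_pos_right a two_pos
  calc m ≤ f (a + 2) := le_of_tendsto hm <| by
        filter_upwards [eventually_gt_atTop (a + 2)] with x hx
        exact (hf h₂ (h₂.trans hx) hx).le
    _ < f (a + 1) := hf h₁ h₂ (by linarith)
    _ ≤ l := ge_of_tendsto hl <| by
        filter_upwards [Ioo_mem_nhdsGT h₁] with x hx
        exact (hf hx.1 h₁ hx.2).le

/-- The Pohozaev function `½ τ v'² - ½ v v' + τ Q v^{p+1} / (p+1)` of the Emden-Fowler equation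
`v'' = -Q v^p`; the argument `v'` stands for the derivative of `v`. -/
def pohozaev (p : ℕ) (Q v v' : ℝ → ℝ) (τ : ℝ) : ℝ :=
  τ * v' τ ^ 2 / 2 - v τ * v' τ / 2 + τ * Q τ * v τ ^ (p + 1) / (p + 1)

variable {p : ℕ} {Q Q' v v' : ℝ → ℝ} {τ : ℝ}

lemma hasDerivAt_pohozaev (hv : HasDerivAt v (v' τ) τ)
    (hv' : HasDerivAt v' (-Q τ * v τ ^ p) τ) (hQ : HasDerivAt Q (Q' τ) τ) :
    HasDerivAt (pohozaev p Q v v')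
      (((p + 3) / 2 * Q τ + τ * Q' τ) * v τ ^ (p + 1) / (p + 1)) τ := by
  have hp : (p + 1 : ℝ) ≠ 0 := by positivity
  refine (((((hasDerivAt_id' τ).fun_mul (hv'.fun_pow 2)).div_const 2).fun_sub
    ((hv.fun_mul hv').div_const 2)).fun_add
    ((((hasDerivAt_id' τ).fun_mul hQ).fun_mul (hv.fun_pow (p + 1))).div_const _)).congr_deriv ?_
  push_cast
  field_simp
  ring

theorem false_of_tendsto_pohozaev (hv : ∀ τ, 0 < τ → HasDerivAt v (v' τ) τ)
    (hv' : ∀ τ, 0 < τ → HasDerivAt v' (-Q τ * v τ ^ p) τ)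
    (hQ : ∀ τ, 0 < τ → HasDerivAt Q (Q' τ) τ) (hpos : ∀ τ, 0 < τ → 0 < v τ)
    (hneg : ∀ τ, 0 < τ → (p + 3) / 2 * Q τ + τ * Q' τ < 0)
    (hzero : Tendsto (pohozaev p Q v v') (𝓝[>] 0) (𝓝 0))
    (htop : Tendsto (pohozaev p Q v v') atTop (𝓝 0)) : False := by
  have hderiv := fun τ hτ => hasDerivAt_pohozaev (hv τ hτ) (hv' τ hτ) (hQ τ hτ)
  have hanti : StrictAntiOn (pohozaev p Q v v') (Set.Ioi 0) :=
    strictAntiOn_of_hasDerivWithinAt_neg (convex_Ioi 0)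
      (fun τ hτ => (hderiv τ hτ).continuousAt.continuousWithinAt)
      (fun τ hτ => (hderiv τ (interior_subset hτ)).hasDerivWithinAt)
      fun τ hτ => div_neg_of_neg_of_pos (mul_neg_of_neg_of_pos (hneg τ (interior_subset hτ))
        (pow_pos (hpos τ (interior_subset hτ)) _)) (by positivity)
  exact lt_irrefl _ (lt_of_strictAntiOn_of_tendsto hanti hzero htop)

section Substitution

variable {N τ : ℝ} {φ κ : ℝ → ℝ}

/-- The independent variable `w` as a function of the Emden-Fowler variable `τ`, determined by
`1 + N w = e^{2τ}`. -/
def substVar (N τ : ℝ) : ℝ := (Real.exp (2 * τ) - 1) / N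

/-- The Emden-Fowler transform `w φ(w) / (1 + N w)` of `φ`. -/
def substFun (N : ℝ) (φ : ℝ → ℝ) (τ : ℝ) : ℝ :=
  Real.exp (-(2 * τ)) * (substVar N τ * φ (substVar N τ))

/-- The derivative of `substFun N φ`. -/
def substDeriv (N : ℝ) (φ : ℝ → ℝ) (τ : ℝ) : ℝ :=
  2 / N * (substVar N τ * deriv φ (substVar N τ) + Real.exp (-(2 * τ)) * φ (substVar N τ))

/-- The coefficient of the cubic term after the Emden-Fowler transform. -/
def substPotential (N : ℝ) (κ : ℝ → ℝ) (τ : ℝ) : ℝ :=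
  κ (substVar N τ) * (Real.cosh τ / (4 * Real.sinh τ ^ 3))

lemma one_add_mul_substVar (hN : N ≠ 0) (τ : ℝ) : 1 + N * substVar N τ = Real.exp (2 * τ) := by
  rw [substVar]
  field_simp
  ring

lemma substVar_pos (hN : 0 < N) (hτ : 0 < τ) : 0 < substVar N τ :=
  div_pos (sub_pos.2 (Real.one_lt_exp_iff.2 (by linarith))) hN

lemma hasDerivAt_exp_neg_two_mul (τ : ℝ) :
    HasDerivAt (fun τ => Real.exp (-(2 * τ))) (-2 * Real.exp (-(2 * τ))) τ :=
  (((hasDerivAt_id' τ).const_mul 2).fun_neg.exp).congr_deriv (by ring)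

lemma hasDerivAt_substVar (N τ : ℝ) :
    HasDerivAt (substVar N) (2 / N * Real.exp (2 * τ)) τ :=
  ((((hasDerivAt_id' τ).const_mul 2).exp.sub_const 1).div_const N).congr_deriv (by ring)

lemma hasDerivAt_substFun (hN : N ≠ 0) (hφ : DifferentiableAt ℝ φ (substVar N τ)) :
    HasDerivAt (substFun N φ) (substDeriv N φ τ) τ := by
  have hw := hasDerivAt_substVar N τ
  refine ((hasDerivAt_exp_neg_two_mul τ).fun_mul
    (hw.fun_mul (hφ.hasDerivAt.comp τ hw))).congr_deriv ?_
  have hexp : Real.exp (2 * τ) = 1 + N * substVar N τ := (one_add_mul_substVar hN τ).symm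
  have := Real.exp_pos (2 * τ)
  simp only [substDeriv, Real.exp_neg, Function.comp_apply]
  rw [hexp] at this ⊢
  field_simp
  ring

lemma cosh_div_sinh_pow_three (hN : 0 < N) (hτ : 0 < τ) :
    Real.cosh τ / (4 * Real.sinh τ ^ 3)
      = (1 + N * substVar N τ) * (2 + N * substVar N τ) / (N * substVar N τ) ^ 3 := by
  have hw := substVar_pos hN hτ
  have hτ' : Real.exp τ ^ 2 = 1 + N * substVar N τ := by
    rw [one_add_mul_substVar hN.ne', ← Real.exp_nat_mul, Nat.cast_ofNat]
  have hsub : Real.exp τ ^ 2 - 1 ≠ 0 := by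
    rw [hτ', add_sub_cancel_left]
    positivity
  have hNw : N * substVar N τ = Real.exp τ ^ 2 - 1 := by linarith
  have := Real.exp_pos τ
  rw [Real.cosh_eq, Real.sinh_eq, Real.exp_neg, hNw]
  have hinv : Real.exp τ - (Real.exp τ)⁻¹ = (Real.exp τ ^ 2 - 1) / Real.exp τ := by field_simp
  rw [hinv]
  field_simp
  ring

lemma hasDerivAt_substDeriv (hN : 0 < N) (hτ : 0 < τ) (hφ : ContDiffAt ℝ 2 φ (substVar N τ))
    (hode : ∀ w, 0 < w → (1 + N * w) *
        (w * (1 + N * w) * deriv (deriv φ) w + (2 + N * w) * deriv φ w) - N * φ w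
      = -((2 + N * w) / (4 * N * (1 + N * w)) * κ w * φ w ^ 3)) :
    HasDerivAt (substDeriv N φ) (-substPotential N κ τ * substFun N φ τ ^ 3) τ := by
  have hw := hasDerivAt_substVar N τ
  have hpos := substVar_pos hN hτ
  have hφ₁ := (hφ.differentiableAt two_ne_zero).hasDerivAt.comp τ hw
  have hφ₂ := ((hφ.derivWithin (m := 1) (by norm_num)).differentiableAt
    one_ne_zero).hasDerivAt.comp τ hw
  refine (((hw.fun_mul hφ₂).fun_add ((hasDerivAt_exp_neg_two_mul τ).fun_mul hφ₁)).const_mul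
    (2 / N)).congr_deriv ?_
  have hexp : Real.exp (2 * τ) = 1 + N * substVar N τ := (one_add_mul_substVar hN.ne' τ).symm
  have heq := hode _ hpos
  simp only [substPotential, substFun, cosh_div_sinh_pow_three hN hτ, Real.exp_neg, hexp,
    Function.comp_apply]
  generalize substVar N τ = w at *
  have hm : 1 + N * w ≠ 0 := by positivity
  linear_combination (norm := (field_simp; ring)) (4 / (N ^ 2 * (1 + N * w))) * heq

lemma hasDerivAt_cosh_div_sinh_pow_three (hτ : τ ≠ 0) :
    HasDerivAt (fun τ => Real.cosh τ / (4 * Real.sinh τ ^ 3))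
      (-(2 + Real.cosh (2 * τ)) / (4 * Real.sinh τ ^ 4)) τ := by
  have hs : Real.sinh τ ≠ 0 := Real.sinh_ne_zero.2 hτ
  refine ((Real.hasDerivAt_cosh τ).fun_div
    (((Real.hasDerivAt_sinh τ).fun_pow 3).const_mul 4) (by positivity)).congr_deriv ?_
  rw [Real.cosh_two_mul]
  push_cast
  field_simp
  linear_combination (-2) * Real.cosh_sq τ

lemma hasDerivAt_substPotential (hτ : τ ≠ 0) (hκ : DifferentiableAt ℝ κ (substVar N τ)) :
    HasDerivAt (substPotential N κ)
      (deriv κ (substVar N τ) * (2 / N * Real.exp (2 * τ)) * (Real.cosh τ / (4 * Real.sinh τ ^ 3))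
        + κ (substVar N τ) * (-(2 + Real.cosh (2 * τ)) / (4 * Real.sinh τ ^ 4))) τ :=
  (hκ.hasDerivAt.comp τ (hasDerivAt_substVar N τ)).fun_mul (hasDerivAt_cosh_div_sinh_pow_three hτ)

lemma three_mul_cosh_div_sinh_pow_three_lt (hτ : 0 < τ) :
    3 * (Real.cosh τ / (4 * Real.sinh τ ^ 3))
      < τ * ((2 + Real.cosh (2 * τ)) / (4 * Real.sinh τ ^ 4)) := by
  have := Real.sinh_pos_iff.2 hτ
  have hcusa := three_mul_sinh_lt_mul_two_add_cosh (x := 2 * τ) (by linarith)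
  rw [Real.sinh_two_mul] at hcusa
  calc 3 * (Real.cosh τ / (4 * Real.sinh τ ^ 3))
      = 3 * (Real.sinh τ * Real.cosh τ) / (4 * Real.sinh τ ^ 4) := by field_simp
    _ < τ * (2 + Real.cosh (2 * τ)) / (4 * Real.sinh τ ^ 4) :=
        div_lt_div_of_pos_right (by linarith) (by positivity)
    _ = _ := mul_div_assoc _ _ _

lemma three_mul_substPotential_add_neg (hN : 0 < N) (hτ : 0 < τ) (hκ : 0 < κ (substVar N τ))
    (hκ' : deriv κ (substVar N τ) ≤ 0) :
    3 * substPotential N κ τ + τ * (deriv κ (substVar N τ) * (2 / N * Real.exp (2 * τ))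
        * (Real.cosh τ / (4 * Real.sinh τ ^ 3))
      + κ (substVar N τ) * (-(2 + Real.cosh (2 * τ)) / (4 * Real.sinh τ ^ 4))) < 0 := by
  have := Real.sinh_pos_iff.2 hτ
  have := Real.cosh_pos τ
  have h₁ : τ * (2 / N * Real.exp (2 * τ) * (Real.cosh τ / (4 * Real.sinh τ ^ 3)))
      * deriv κ (substVar N τ) ≤ 0 := mul_nonpos_of_nonneg_of_nonpos (by positivity) hκ'
  have h₂ := mul_lt_mul_of_pos_left (three_mul_cosh_div_sinh_pow_three_lt hτ) hκ
  rw [substPotential, neg_div]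
  linarith

end Substitution

section Boundary

variable {N a b c : ℝ} {φ κ : ℝ → ℝ}

lemma tendsto_substVar_nhdsGT_zero (hN : 0 < N) :
    Tendsto (substVar N) (𝓝[>] 0) (𝓝[>] 0) := by
  refine tendsto_nhdsWithin_iff.2 ⟨?_, eventually_nhdsWithin_of_forall fun _ => substVar_pos hN⟩
  have h := (hasDerivAt_substVar N 0).continuousAt.tendsto
  rw [show substVar N 0 = 0 by simp [substVar]] at h
  exact h.mono_left nhdsWithin_le_nhds

lemma tendsto_substVar_atTop (hN : 0 < N) : Tendsto (substVar N) atTop atTop :=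
  (tendsto_atTop_add_const_right _ (-1) (Real.tendsto_exp_atTop.comp
    (tendsto_id.const_mul_atTop two_pos))).atTop_div_const hN

lemma exp_neg_mul_substVar (τ : ℝ) :
    Real.exp (-(2 * τ)) * substVar N τ = (1 - Real.exp (-(2 * τ))) / N := by
  rw [substVar, ← mul_div_assoc, mul_sub_one, ← Real.exp_add, neg_add_cancel, Real.exp_zero]

lemma pohozaev_subst_eq (hN : 0 < N) {τ : ℝ} (hτ : 0 < τ) :
    pohozaev 3 (substPotential N κ) (substFun N φ) (substDeriv N φ) τ
      = τ * substDeriv N φ τ ^ 2 / 2 - substFun N φ τ * substDeriv N φ τ / 2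
        + τ * Real.exp (-(2 * τ)) * ((1 - Real.exp (-(2 * τ)) ^ 2) / (4 * N ^ 4)
          * (κ (substVar N τ) * φ (substVar N τ) ^ 4)) := by
  have hw := substVar_pos hN hτ
  have hz : Real.exp (-(2 * τ)) = (1 + N * substVar N τ)⁻¹ := by
    rw [one_add_mul_substVar hN.ne', Real.exp_neg]
  simp only [pohozaev, substPotential, cosh_div_sinh_pow_three hN hτ, substFun, hz]
  generalize substVar N τ = w at *
  push_cast
  field_simp
  ring

lemma tendsto_pohozaev_nhdsGT_zero (hN : 0 < N) (hφ : Tendsto φ (𝓝[>] 0) (𝓝 a))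
    (hκ : Tendsto κ (𝓝[>] 0) (𝓝 b)) (hφ' : Tendsto (fun w => w * deriv φ w) (𝓝[>] 0) (𝓝 0)) :
    Tendsto (pohozaev 3 (substPotential N κ) (substFun N φ) (substDeriv N φ)) (𝓝[>] 0) (𝓝 0) := by
  have hw := tendsto_substVar_nhdsGT_zero hN
  have hτ : Tendsto id (𝓝[>] (0 : ℝ)) (𝓝 0) := nhdsWithin_le_nhds
  have hz : Tendsto (fun τ : ℝ => Real.exp (-(2 * τ))) (𝓝[>] 0) (𝓝 1) := by
    simpa using (hτ.const_mul 2).neg.rexp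
  have hφw := hφ.comp hw
  have hv : Tendsto (substFun N φ) (𝓝[>] 0) (𝓝 0) := by
    simpa using! hz.mul ((hw.mono_right nhdsWithin_le_nhds).mul hφw)
  have hv' : Tendsto (substDeriv N φ) (𝓝[>] 0) (𝓝 (2 / N * (0 + 1 * a))) :=
    ((hφ'.comp hw).add (hz.mul hφw)).const_mul _
  refine Tendsto.congr' (eventually_nhdsWithin_of_forall fun τ hτ =>
    (pohozaev_subst_eq hN hτ).symm) ?_
  simpa using! (((hτ.mul (hv'.pow 2)).div_const 2).sub ((hv.mul hv').div_const 2)).add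
    ((hτ.mul hz).mul ((((hz.pow 2).const_sub 1).div_const (4 * N ^ 4)).mul
      ((hκ.comp hw).mul (hφw.pow 4))))

lemma sqrt_substVar (N τ : ℝ) :
    √(substVar N τ) = Real.exp τ * √((1 - Real.exp (-(2 * τ))) / N) := by
  have hexp : Real.exp τ ^ 2 * Real.exp (-(2 * τ)) = 1 := by
    rw [← Real.exp_nat_mul, ← Real.exp_add, Nat.cast_ofNat, add_neg_cancel, Real.exp_zero]
  calc √(substVar N τ)
      = √(Real.exp τ ^ 2 * ((1 - Real.exp (-(2 * τ))) / N)) := by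
        rw [← exp_neg_mul_substVar, ← mul_assoc, hexp, one_mul]
    _ = _ := by rw [Real.sqrt_mul (sq_nonneg _), Real.sqrt_sq (Real.exp_pos τ).le]

lemma tendsto_exp_neg_two_mul_atTop :
    Tendsto (fun τ : ℝ => Real.exp (-(2 * τ))) atTop (𝓝 0) :=
  Real.tendsto_exp_neg_atTop_nhds_zero.comp (tendsto_id.const_mul_atTop two_pos)

lemma tendsto_mul_exp_neg_two_mul_atTop :
    Tendsto (fun τ : ℝ => τ * Real.exp (-(2 * τ))) atTop (𝓝 0) := by
  simpa using! ((Real.tendsto_pow_mul_exp_neg_atTop_nhds_zero 1).mul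
    Real.tendsto_exp_neg_atTop_nhds_zero).congr fun τ => by
      rw [pow_one, mul_assoc, ← Real.exp_add, two_mul, neg_add]

lemma tendsto_exp_mul_substDeriv_atTop (hN : 0 < N) (hφ : Tendsto φ atTop (𝓝 a))
    (hφ' : Tendsto (fun w => √w * (w * deriv φ w)) atTop (𝓝 c)) :
    Tendsto (fun τ => Real.exp τ * substDeriv N φ τ) atTop (𝓝 (2 / N * (c / √(1 / N)))) := by
  have hw := tendsto_substVar_atTop hN
  have hsqrt : Tendsto (fun τ => √((1 - Real.exp (-(2 * τ))) / N)) atTop (𝓝 √(1 / N)) := by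
    simpa using ((tendsto_exp_neg_two_mul_atTop.const_sub 1).div_const N).sqrt
  have hsqrt₀ : √(1 / N) ≠ 0 := by positivity
  have hlim := (((hφ'.comp hw).div hsqrt hsqrt₀).add
    (Real.tendsto_exp_neg_atTop_nhds_zero.mul (hφ.comp hw))).const_mul (2 / N)
  rw [zero_mul, add_zero] at hlim
  refine hlim.congr' ?_
  filter_upwards [hsqrt.eventually_ne hsqrt₀] with τ hτ
  have hexp : Real.exp τ * Real.exp (-(2 * τ)) = Real.exp (-τ) := by
    rw [← Real.exp_add]
    ring_nf
  simp only [Function.comp_apply, substDeriv, Pi.div_apply, sqrt_substVar]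
  rw [← hexp]
  field_simp

lemma tendsto_pohozaev_atTop (hN : 0 < N) (hφ : Tendsto φ atTop (𝓝 a))
    (hκ : Tendsto κ atTop (𝓝 b)) (hφ' : Tendsto (fun w => √w * (w * deriv φ w)) atTop (𝓝 c)) :
    Tendsto (pohozaev 3 (substPotential N κ) (substFun N φ) (substDeriv N φ)) atTop (𝓝 0) := by
  have hw := tendsto_substVar_atTop hN
  have hφw := hφ.comp hw
  have hz := tendsto_exp_neg_two_mul_atTop
  have hτz := tendsto_mul_exp_neg_two_mul_atTop
  have hexp := tendsto_exp_mul_substDeriv_atTop hN hφ hφ'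
  have hv : Tendsto (substFun N φ) atTop (𝓝 (1 / N * a)) := by
    simpa using! (((hz.const_sub 1).div_const N).mul hφw).congr fun τ => by
      rw [← exp_neg_mul_substVar, mul_assoc]; rfl
  have hv' : Tendsto (substDeriv N φ) atTop (𝓝 0) := by
    simpa using (Real.tendsto_exp_neg_atTop_nhds_zero.mul hexp).congr fun τ => by
      rw [← mul_assoc, ← Real.exp_add, neg_add_cancel, Real.exp_zero, one_mul]
  have hτv' : Tendsto (fun τ => τ * substDeriv N φ τ ^ 2) atTop (𝓝 0) := by
    simpa using (hτz.mul (hexp.pow 2)).congr fun τ => by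
      rw [Real.exp_neg, mul_comm 2 τ, Real.exp_mul, Real.rpow_two]
      field_simp
  refine Tendsto.congr' ((eventually_gt_atTop 0).mono fun τ hτ =>
    (pohozaev_subst_eq hN hτ).symm) ?_
  simpa using! ((hτv'.div_const 2).sub ((hv.mul hv').div_const 2)).add
    (hτz.mul ((((hz.pow 2).const_sub 1).div_const (4 * N ^ 4)).mul
      ((hκ.comp hw).mul (hφw.pow 4))))

theorem false_of_ode {a₀ a₁ b₀ b₁ : ℝ} (hN : 0 < N) (hφ : ∀ w, 0 < w → ContDiffAt ℝ 2 φ w)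
    (hκ : ∀ w, 0 < w → DifferentiableAt ℝ κ w) (hφpos : ∀ w, 0 < w → 0 < φ w)
    (hκpos : ∀ w, 0 < w → 0 < κ w) (hκ' : ∀ w, 0 < w → deriv κ w ≤ 0)
    (hode : ∀ w, 0 < w → (1 + N * w) *
        (w * (1 + N * w) * deriv (deriv φ) w + (2 + N * w) * deriv φ w) - N * φ w
      = -((2 + N * w) / (4 * N * (1 + N * w)) * κ w * φ w ^ 3))
    (hφ₀ : Tendsto φ (𝓝[>] 0) (𝓝 a₀)) (hκ₀ : Tendsto κ (𝓝[>] 0) (𝓝 b₀))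
    (hφ'₀ : Tendsto (fun w => w * deriv φ w) (𝓝[>] 0) (𝓝 0))
    (hφ₁ : Tendsto φ atTop (𝓝 a₁)) (hκ₁ : Tendsto κ atTop (𝓝 b₁))
    (hφ'₁ : Tendsto (fun w => √w * (w * deriv φ w)) atTop (𝓝 c)) : False := by
  refine false_of_tendsto_pohozaev (p := 3) (Q := substPotential N κ)
    (fun τ hτ => hasDerivAt_substFun hN.ne'
      ((hφ _ (substVar_pos hN hτ)).differentiableAt two_ne_zero))
    (fun τ hτ => hasDerivAt_substDeriv hN hτ (hφ _ (substVar_pos hN hτ)) hode)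
    (fun τ hτ => hasDerivAt_substPotential hτ.ne' (hκ _ (substVar_pos hN hτ)))
    (fun τ hτ => mul_pos (Real.exp_pos _) (mul_pos (substVar_pos hN hτ)
      (hφpos _ (substVar_pos hN hτ)))) (fun τ hτ => ?_)
    (tendsto_pohozaev_nhdsGT_zero hN hφ₀ hκ₀ hφ'₀) (tendsto_pohozaev_atTop hN hφ₁ hκ₁ hφ'₁)
  have hw := substVar_pos hN hτ
  convert three_mul_substPotential_add_neg hN hτ (hκpos _ hw) (hκ' _ hw) using 2
  norm_num

end Boundary

end EmdenFowler

/-! ### Reduction to an ordinary differential equation -/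

namespace LeBrun

open ChartGeometry

section Metric

/-- The function `(1 + w)^a (1 + N w)^b`; the eigenvalues of `ǧ` in the orbifold chart are of this
form, with `N = n` and `w = s²`. -/
def weight (N : ℝ) (a b : ℤ) (w : ℝ) : ℝ := (1 + w) ^ a * (1 + N * w) ^ b

/-- The coefficient of `(∑ xᵢ dxᵢ)²` in `ǧ`, as a function of `w = |x|²`. -/
def coeffRadial (N w : ℝ) : ℝ := -N * weight N 1 (-3) w

/-- The coefficient of `(∑ (Jx)ᵢ dxᵢ)²` in `ǧ`, as a function of `w = |x|²`. -/
def coeffHopf (N w : ℝ) : ℝ := (N - 2 - w) * weight N (-1) (-2) w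

/-- The orbifold chart without its constant last coordinate, as a linear map. -/
def chartLinear : (Fin 4 → ℝ) →L[ℝ] (Fin 2 → ℂ) × ℂ :=
  LinearMap.toContinuousLinearMap
    { toFun := fun x => (![⟨x 0, x 1⟩, ⟨x 2, x 3⟩], 0)
      map_add' := fun x y => by
        ext i
        · fin_cases i <;> simp [Complex.ext_iff]
        · simp
      map_smul' := fun c x => by
        ext i
        · fin_cases i <;> simp [Complex.ext_iff]
        · simp }

lemma chartLinear_apply (x : Fin 4 → ℝ) : chartLinear x = (![⟨x 0, x 1⟩, ⟨x 2, x 3⟩], 0) := rfl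

lemma fderiv_homChart_zero (x v : Fin 4 → ℝ) : fderiv ℝ (homChart 0) x v = chartLinear v := by
  have : homChart 0 = fun x => chartLinear x + (0, 1) := by
    funext x
    simp [homChart, chartLinear_apply]
  rw [this, fderiv_add_const, chartLinear.fderiv]

lemma wSq_homChart_zero (x : Fin 4 → ℝ) : wSq (homChart 0 x) = normSq x := by
  simp only [wSq, homChart, normSq, dotProduct, Fin.sum_univ_four, Matrix.cons_val_zero,
    Matrix.cons_val_one, Complex.normSq_mk]
  ring

lemma ySq_homChart_zero (x : Fin 4 → ℝ) : ySq (homChart 0 x) = 1 := by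
  simp [ySq, homChart]

lemma metric_zero_eq_radialMetric (n : ℕ) :
    metric n 0
      = radialMetric complexStructure (weight n 1 (-2)) (coeffRadial n) (coeffHopf n) := by
  funext x
  ext i j
  have hy : ∀ v, yForm (homChart 0 x) (chartLinear v) = 0 := fun v => by
    simp [yForm, chartLinear_apply]
  have hre : ∀ m, (wForm (homChart 0 x) (chartLinear (Pi.single m 1))).re = x m := fun m => by
    fin_cases m <;> simp [wForm, homChart, chartLinear_apply]
  have him : ∀ m, (wForm (homChart 0 x) (chartLinear (Pi.single m 1))).im
      = complexStructure.mulVec x m := fun m => by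
    fin_cases m <;>
      simp [wForm, homChart, chartLinear_apply, complexStructure, Matrix.mulVec, dotProduct,
        Fin.sum_univ_four]
  have hww : (wForm (chartLinear (Pi.single i 1)) (chartLinear (Pi.single j 1))).re
      = (1 : Matrix (Fin 4) (Fin 4) ℝ) i j := by
    fin_cases i <;> fin_cases j <;> simp [wForm, chartLinear_apply]
  have hyy : (yForm (chartLinear (Pi.single i 1)) (chartLinear (Pi.single j 1))).re = 0 := by
    simp [yForm, chartLinear_apply]
  rw [radialMetric_apply, Matrix.one_mulVec]
  simp only [metric, Matrix.of_apply, fderiv_homChart_zero, homMetric, wSq_homChart_zero,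
    ySq_homChart_zero, hy, hre, him, hww, hyy, Complex.zero_re, Complex.zero_im, weight,
    coeffRadial, coeffHopf, zpow_neg, zpow_ofNat]
  have := normSq_nonneg x
  field_simp
  ring

variable {N w : ℝ}

lemma weight_pos (hN : 0 ≤ N) (hw : 0 ≤ w) (a b : ℤ) : 0 < weight N a b w := by
  unfold weight
  positivity

lemma eigenvalue_coeffRadial : eigenvalue (weight N 1 (-2)) (coeffRadial N) = weight N 1 (-3) := by
  funext w
  simp only [eigenvalue, coeffRadial, weight, zpow_neg, zpow_ofNat]
  by_cases hm : 1 + N * w = 0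
  · simp [hm]
  · field_simp
    ring

lemma eigenvalue_coeffHopf : eigenvalue (weight N 1 (-2)) (coeffHopf N) = weight N (-1) (-1) := by
  funext w
  simp only [eigenvalue, coeffHopf, weight, zpow_neg, zpow_ofNat]
  by_cases hm : 1 + N * w = 0
  · simp [hm]
  by_cases hl : 1 + w = 0
  · simp [hl]
  · have : 1 + w * N ≠ 0 := by rwa [mul_comm w]
    field_simp
    ring

lemma contDiffAt_weight (hN : 0 ≤ N) (hw : 0 ≤ w) (a b : ℤ) :
    ContDiffAt ℝ 2 (weight N a b) w := by
  have hzpow : ∀ {x : ℝ} (k : ℤ), 0 < x → ContDiffAt ℝ 2 (fun y : ℝ => y ^ k) x :=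
    fun k hx => (analyticAt_id.fun_zpow hx.ne').contDiffAt
  exact ((hzpow a (by positivity)).comp w (by fun_prop)).mul
    ((hzpow b (by positivity)).comp w (by fun_prop))

lemma contDiffAt_coeffRadial (hN : 0 ≤ N) (hw : 0 ≤ w) : ContDiffAt ℝ 2 (coeffRadial N) w :=
  contDiffAt_const.mul (contDiffAt_weight hN hw 1 (-3))

lemma contDiffAt_coeffHopf (hN : 0 ≤ N) (hw : 0 ≤ w) : ContDiffAt ℝ 2 (coeffHopf N) w :=
  (contDiffAt_const.sub contDiffAt_id).mul (contDiffAt_weight hN hw (-1) (-2))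

lemma hasDerivAt_weight (hl : 1 + w ≠ 0) (hm : 1 + N * w ≠ 0) (a b : ℤ) :
    HasDerivAt (weight N a b) (weight N a b w * (a / (1 + w) + b * N / (1 + N * w))) w := by
  have hl₁ : HasDerivAt (fun v => (1 + v) ^ a) (a * (1 + w) ^ (a - 1)) w := by
    simpa using! (hasDerivAt_zpow a (1 + w) (.inl hl)).comp w ((hasDerivAt_id w).const_add 1)
  have hm₁ : HasDerivAt (fun v => (1 + N * v) ^ b) (b * (1 + N * w) ^ (b - 1) * N) w := by
    simpa using! (hasDerivAt_zpow b (1 + N * w) (.inl hm)).comp w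
      (((hasDerivAt_id w).const_mul N).const_add 1)
  refine (hl₁.fun_mul hm₁).congr_deriv ?_
  rw [weight, zpow_sub_one₀ hl, zpow_sub_one₀ hm]
  ring

lemma logDeriv_weight (hN : 0 ≤ N) (hw : 0 ≤ w) (a b : ℤ) :
    logDeriv (weight N a b) w = a / (1 + w) + b * N / (1 + N * w) := by
  rw [logDeriv_apply, (hasDerivAt_weight (by positivity) (by positivity) a b).deriv,
    mul_div_cancel_left₀ _ (weight_pos hN hw a b).ne']

lemma deriv_deriv_weight (hN : 0 ≤ N) (hw : 0 ≤ w) (a b : ℤ) :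
    deriv (deriv (weight N a b)) w = weight N a b w *
      ((a / (1 + w) + b * N / (1 + N * w)) ^ 2 - a / (1 + w) ^ 2
        - b * N ^ 2 / (1 + N * w) ^ 2) := by
  have hl : 1 + w ≠ 0 := by positivity
  have hm : 1 + N * w ≠ 0 := by positivity
  have hderiv : deriv (weight N a b)
      =ᶠ[𝓝 w] fun v => weight N a b v * (a / (1 + v) + b * N / (1 + N * v)) := by
    filter_upwards [(continuous_const.add continuous_id).continuousAt.eventually_ne hl,
      (continuous_const.add (continuous_const.mul continuous_id)).continuousAt.eventually_ne hm]
      with v hlv hmv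
    exact (hasDerivAt_weight hlv hmv a b).deriv
  have hl₁ : HasDerivAt (fun v => (a : ℝ) / (1 + v)) (-a / (1 + w) ^ 2) w := by
    simpa using (hasDerivAt_const w (a : ℝ)).fun_div ((hasDerivAt_id' w).const_add 1) hl
  have hm₁ : HasDerivAt (fun v => b * N / (1 + N * v)) (-(b * N * N) / (1 + N * w) ^ 2) w := by
    simpa using (hasDerivAt_const w (b * N : ℝ)).fun_div
      (((hasDerivAt_id' w).const_mul N).const_add 1) hm
  rw [hderiv.deriv_eq, ((hasDerivAt_weight hl hm a b).fun_mul (hl₁.fun_add hm₁)).deriv]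
  ring

lemma laplacian_metric_axis {n : ℕ} {φ : ℝ → ℝ} {t : ℝ} (hφ : ContDiffAt ℝ 2 φ (t ^ 2)) :
    laplacian (metric n 0) (fun z => φ (normSq z)) ![t, 0, 0, 0]
      = 4 * (1 + n * t ^ 2) ^ 2 / (1 + t ^ 2) *
        (t ^ 2 * (1 + n * t ^ 2) * deriv (deriv φ) (t ^ 2)
          + (2 + n * t ^ 2) * deriv φ (t ^ 2)) := by
  have hN : (0 : ℝ) ≤ n := n.cast_nonneg
  have hw := sq_nonneg t
  rw [metric_zero_eq_radialMetric, laplacian_radialMetric_axis (contDiffAt_weight hN hw 1 (-2))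
    (contDiffAt_coeffRadial hN hw) (contDiffAt_coeffHopf hN hw) hφ (weight_pos hN hw _ _).ne'
    (eigenvalue_coeffRadial ▸ (weight_pos hN hw _ _).ne')
    (eigenvalue_coeffHopf ▸ (weight_pos hN hw _ _).ne'),
    eigenvalue_coeffRadial, eigenvalue_coeffHopf]
  simp only [logDeriv_weight hN hw]
  simp only [weight, zpow_neg, zpow_ofNat]
  push_cast
  field_simp
  ring

lemma scalarCurvature_metric_axis {n : ℕ} {t : ℝ} (ht : t ≠ 0) :
    scalarCurvature (metric n 0) ![t, 0, 0, 0] = 24 * n * (1 + n * t ^ 2) / (1 + t ^ 2) := by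
  have hN : (0 : ℝ) ≤ n := n.cast_nonneg
  have hw := sq_nonneg t
  rw [metric_zero_eq_radialMetric, scalarCurvature_radialMetric_axis
    (contDiffAt_weight hN hw 1 (-2)) (contDiffAt_coeffRadial hN hw)
    (contDiffAt_coeffHopf hN hw) ht (weight_pos hN hw _ _).ne'
    (eigenvalue_coeffRadial ▸ (weight_pos hN hw _ _).ne')
    (eigenvalue_coeffHopf ▸ (weight_pos hN hw _ _).ne'),
    eigenvalue_coeffRadial, eigenvalue_coeffHopf]
  simp only [logDeriv_weight hN hw, deriv_deriv_weight hN hw]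
  simp only [weight, zpow_neg, zpow_ofNat]
  push_cast
  field_simp
  ring

end Metric

section FunctionSpace

variable {n : ℕ}

lemma wSq_nonneg (h : (Fin 2 → ℂ) × ℂ) : 0 ≤ wSq h :=
  add_nonneg (Complex.normSq_nonneg _) (Complex.normSq_nonneg _)

lemma ySq_nonneg (h : (Fin 2 → ℂ) × ℂ) : 0 ≤ ySq h := Complex.normSq_nonneg _

lemma wSq_add_ySq_pos {h : (Fin 2 → ℂ) × ℂ} (h0 : h ≠ 0) : 0 < wSq h + ySq h := by
  refine (add_nonneg (wSq_nonneg h) (ySq_nonneg h)).lt_of_ne' fun hsum => h0 ?_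
  have hw := wSq_nonneg h
  have hy := ySq_nonneg h
  have hw0 : wSq h = 0 := by linarith
  obtain ⟨h₁, h₂⟩ :=
    (add_eq_zero_iff_of_nonneg (Complex.normSq_nonneg _) (Complex.normSq_nonneg _)).1 hw0
  ext i
  · fin_cases i
    · exact Complex.normSq_eq_zero.1 h₁
    · exact Complex.normSq_eq_zero.1 h₂
  · exact Complex.normSq_eq_zero.1 (show ySq h = 0 by linarith)

lemma s_mk (n : ℕ) (h : Hom) :
    s n (mk n h) = ENNReal.ofReal (√(wSq h.1)) / ENNReal.ofReal (√(ySq h.1)) := rfl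

lemma s_mk_eq_top_iff (h : Hom) : s n (mk n h) = ⊤ ↔ ySq h.1 = 0 := by
  have hpos := wSq_add_ySq_pos h.2
  have hy : ENNReal.ofReal √(ySq h.1) = 0 ↔ ySq h.1 = 0 := by
    rw [ENNReal.ofReal_eq_zero, Real.sqrt_le_left le_rfl, zero_pow two_ne_zero]
    exact ⟨fun h0 => h0.antisymm (ySq_nonneg _), le_of_eq⟩
  simp only [s_mk, ENNReal.div_eq_top, ENNReal.ofReal_ne_top, false_and, or_false, hy,
    and_iff_right_iff_imp]
  intro h0
  rw [h0, add_zero] at hpos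
  simpa using hpos

lemma toReal_s_mk_sq (h : Hom) : (s n (mk n h)).toReal ^ 2 = wSq h.1 / ySq h.1 := by
  rw [s_mk, ENNReal.toReal_div, ENNReal.toReal_ofReal (Real.sqrt_nonneg _),
    ENNReal.toReal_ofReal (Real.sqrt_nonneg _), div_pow, Real.sq_sqrt (wSq_nonneg _),
    Real.sq_sqrt (ySq_nonneg _)]

lemma factor_mk (hn : 1 ≤ n) (h : Hom) :
    factor n (mk n h) = (2 * ySq h.1 + n * wSq h.1) / (n * (ySq h.1 + wSq h.1)) := by
  have : (0 : ℝ) < n := by exact_mod_cast hn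
  have hpos := wSq_add_ySq_pos h.2
  have hw := wSq_nonneg h.1
  simp only [factor, s_mk_eq_top_iff, toReal_s_mk_sq]
  split_ifs with hy
  · rw [hy, add_zero] at hpos
    rw [hy]
    field_simp
    ring
  · have hy' : 0 < ySq h.1 := (ySq_nonneg _).lt_of_ne' hy
    field_simp

lemma wSq_mulVec (A : Matrix.unitaryGroup (Fin 2) ℂ) (w : Fin 2 → ℂ) (y : ℂ) :
    wSq ((A : Matrix (Fin 2) (Fin 2) ℂ).mulVec w, y) = wSq (w, y) := by
  have wSq_eq_dotProduct (w : Fin 2 → ℂ) : (wSq (w, y) : ℂ) = dotProduct (star w) w := by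
    simp only [wSq, dotProduct, Fin.sum_univ_two, Pi.star_apply, Complex.ofReal_add,
      Complex.normSq_eq_conj_mul_self]
    rfl
  apply Complex.ofReal_injective
  rw [wSq_eq_dotProduct, wSq_eq_dotProduct, Matrix.star_mulVec, Matrix.dotProduct_mulVec,
    Matrix.vecMul_vecMul, ← Matrix.star_eq_conjTranspose, Matrix.UnitaryGroup.star_mul_self,
    Matrix.vecMul_one]

lemma s_act (A : Matrix.unitaryGroup (Fin 2) ℂ) (p : Orb n) : s n (act n A p) = s n p := by
  induction p using Quotient.inductionOn with
  | h h =>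
    change ENNReal.ofReal (√(wSq ((A : Matrix (Fin 2) (Fin 2) ℂ).mulVec h.1.1, h.1.2))) / _ = _
    rw [wSq_mulVec]
    rfl

lemma factor_act (A : Matrix.unitaryGroup (Fin 2) ℂ) (p : Orb n) :
    factor n (act n A p) = factor n p := by
  simp only [factor, s_act]

lemma contDiff_wSq_homChart (k : Fin 3) : ContDiff ℝ ∞ (fun x => wSq (homChart k x)) := by
  fin_cases k <;> simp only [wSq, homChart, Complex.normSq_apply] <;> fun_prop

lemma contDiff_ySq_homChart (k : Fin 3) : ContDiff ℝ ∞ (fun x => ySq (homChart k x)) := by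
  fin_cases k <;> simp only [ySq, homChart, Complex.normSq_apply] <;> fun_prop

lemma contDiff_factor_comp_chart (hn : 1 ≤ n) (k : Fin 3) :
    ContDiff ℝ ∞ (factor n ∘ chart n k) := by
  have hN : (n : ℝ) ≠ 0 := by exact_mod_cast (zero_lt_one.trans_le hn).ne'
  have hw := contDiff_wSq_homChart k
  have hy := contDiff_ySq_homChart k
  have h_eq : factor n ∘ chart n k = fun x => (2 * ySq (homChart k x) + n * wSq (homChart k x))
      / (n * (ySq (homChart k x) + wSq (homChart k x))) := funext fun x => factor_mk hn _
  rw [h_eq]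
  refine ContDiff.div (by fun_prop) (by fun_prop) fun x => mul_ne_zero hN ?_
  rw [add_comm]
  exact (wSq_add_ySq_pos (homChart_ne_zero k x)).ne'

lemma factor_pos (hn : 1 ≤ n) (p : Orb n) : 0 < factor n p := by
  have : (0 : ℝ) < n := by exact_mod_cast hn
  unfold factor
  split_ifs <;> positivity

lemma factor_mem_X (hn : 1 ≤ n) : factor n ∈ X n :=
  ⟨contDiff_factor_comp_chart hn, factor_act, factor_pos hn⟩

lemma mul_mem_X {f g : Orb n → ℝ} (hf : f ∈ X n) (hg : g ∈ X n) : (fun p => f p * g p) ∈ X n :=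
  ⟨fun k => (hf.1 k).mul (hg.1 k), fun A p => by simp only [hf.2.1, hg.2.1],
    fun p => mul_pos (hf.2.2 p) (hg.2.2 p)⟩

lemma const_div_mem_X {f : Orb n → ℝ} (hf : f ∈ X n) {c : ℝ} (hc : 0 < c) :
    (fun p => c / f p) ∈ X n :=
  ⟨fun k => contDiff_const.div (hf.1 k) fun _ => (hf.2.2 _).ne', fun A p => by simp only [hf.2.1],
    fun p => div_pos hc (hf.2.2 p)⟩

lemma KMinus_mem_X (hn : 1 ≤ n) {K₂ : Orb n → ℝ} (hK : K₂ ∈ X n) : KMinus n K₂ ∈ X n :=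
  mul_mem_X (factor_mem_X hn) hK

lemma factor_mono (hn : 2 ≤ n) {p p' : Orb n} (h : s n p ≤ s n p') : factor n p ≤ factor n p' := by
  have hN : (2 : ℝ) ≤ n := by exact_mod_cast hn
  unfold factor
  split_ifs with h_top h_top' h_top'
  · exact le_rfl
  · exact absurd (top_le_iff.1 (h_top ▸ h)) h_top'
  · rw [div_le_one (by positivity)]
    gcongr
  · have hs : (s n p).toReal ^ 2 ≤ (s n p').toReal ^ 2 := by
      gcongr
    rw [div_le_div_iff₀ (by positivity) (by positivity)]
    nlinarith [mul_nonneg (mul_nonneg (sub_nonneg.2 hN) (sub_nonneg.2 hs))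
      (by linarith : (0 : ℝ) ≤ n)]

end FunctionSpace

section Profile

variable {n : ℕ} {f : Orb n → ℝ}

lemma act_chart_zero {A : Matrix.unitaryGroup (Fin 2) ℂ} {x x' : Fin 4 → ℝ}
    (h : (A : Matrix (Fin 2) (Fin 2) ℂ).mulVec ![⟨x 0, x 1⟩, ⟨x 2, x 3⟩]
      = ![⟨x' 0, x' 1⟩, ⟨x' 2, x' 3⟩]) : act n A (chart n 0 x) = chart n 0 x' :=
  Quotient.sound ⟨1, one_pos, 1, by simpa [homChart] using h.symm, by simp [homChart]⟩

lemma mem_unitaryGroup_of_normSq_add_normSq {a b : ℂ}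
    (h : Complex.normSq a + Complex.normSq b = 1) :
    !![a, -(starRingEnd ℂ) b; b, (starRingEnd ℂ) a] ∈ Matrix.unitaryGroup (Fin 2) ℂ := by
  have h' : (starRingEnd ℂ) a * a + (starRingEnd ℂ) b * b = 1 := by
    rw [← Complex.normSq_eq_conj_mul_self, ← Complex.normSq_eq_conj_mul_self]
    exact_mod_cast h
  rw [Matrix.mem_unitaryGroup_iff']
  ext i j
  fin_cases i <;> fin_cases j <;>
    simp [Matrix.mul_apply, Fin.sum_univ_two, Matrix.star_apply] <;> grind

lemma exists_act_axis_eq (x : Fin 4 → ℝ) :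
    ∃ A, act n A (chart n 0 ![√(normSq x), 0, 0, 0]) = chart n 0 x := by
  rcases (normSq_nonneg x).eq_or_lt' with h | h
  · have hx : x = 0 := dotProduct_self_eq_zero.1 h
    refine ⟨1, act_chart_zero ?_⟩
    ext i
    fin_cases i <;> simp [hx, normSq]
  · set r := √(normSq x)
    have hr : 0 < r := Real.sqrt_pos.2 h
    have hsq : r ^ 2 = x 0 ^ 2 + x 1 ^ 2 + x 2 ^ 2 + x 3 ^ 2 := by
      rw [Real.sq_sqrt h.le, normSq, dotProduct, Fin.sum_univ_four]
      ring
    have hunit : Complex.normSq ⟨x 0 / r, x 1 / r⟩ + Complex.normSq ⟨x 2 / r, x 3 / r⟩ = 1 := by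
      simp only [Complex.normSq_mk]
      field_simp
      linarith
    refine ⟨⟨_, mem_unitaryGroup_of_normSq_add_normSq hunit⟩, act_chart_zero ?_⟩
    ext i
    fin_cases i <;> simp [Matrix.mulVec, dotProduct, Complex.ext_iff, hr.ne']

lemma apply_chart_zero (hf : f ∈ X n) (x : Fin 4 → ℝ) :
    f (chart n 0 x) = radial n f (√(normSq x)) := by
  obtain ⟨A, hA⟩ := exists_act_axis_eq (n := n) x
  rw [← hA, hf.2.1, radial]

lemma contDiff_radial (hf : f ∈ X n) : ContDiff ℝ ∞ (radial n f) := by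
  refine (hf.1 0).comp (contDiff_pi.2 fun i => ?_)
  fin_cases i
  exacts [contDiff_id, contDiff_const, contDiff_const, contDiff_const]

lemma radial_abs (hf : f ∈ X n) (t : ℝ) : radial n f |t| = radial n f t := by
  rw [← Real.sqrt_sq_eq_abs, ← normSq_axis, ← apply_chart_zero hf, radial]

/-- A `U(2)`-invariant function as a function of `w = s²`, the squared norm in the orbifold
chart. -/
def profile (n : ℕ) (f : Orb n → ℝ) (w : ℝ) : ℝ := radial n f (√w)

lemma comp_chart_zero_eq_profile (hf : f ∈ X n) :
    f ∘ chart n 0 = fun z => profile n f (normSq z) :=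
  funext fun z => apply_chart_zero hf z

lemma profile_pos (hf : f ∈ X n) (w : ℝ) : 0 < profile n f w := hf.2.2 _

variable {w : ℝ}

lemma contDiffAt_profile (hf : f ∈ X n) (hw : 0 < w) : ContDiffAt ℝ ∞ (profile n f) w :=
  (contDiff_radial hf).contDiffAt.comp w (Real.contDiffAt_sqrt hw.ne')

lemma mul_deriv_profile (hf : f ∈ X n) (hw : 0 < w) :
    w * deriv (profile n f) w = √w * deriv (radial n f) (√w) / 2 := by
  have hU : HasDerivAt (radial n f) (deriv (radial n f) (√w)) (√w) :=
    ((contDiff_radial hf).differentiable (by simp) _).hasDerivAt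
  have : 0 < √w := Real.sqrt_pos.2 hw
  have hφ : HasDerivAt (profile n f) _ w := hU.comp w (Real.hasDerivAt_sqrt hw.ne')
  rw [hφ.deriv]
  nth_rw 1 [← Real.sq_sqrt hw.le]
  field_simp

lemma continuous_profile (hf : f ∈ X n) : Continuous (profile n f) :=
  (contDiff_radial hf).continuous.comp Real.continuous_sqrt

lemma tendsto_profile_nhdsGT_zero (hf : f ∈ X n) :
    Tendsto (profile n f) (𝓝[>] 0) (𝓝 (profile n f 0)) :=
  (continuous_profile hf).continuousAt.mono_left nhdsWithin_le_nhds

lemma tendsto_mul_deriv_profile_nhdsGT_zero (hf : f ∈ X n) :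
    Tendsto (fun w => w * deriv (profile n f) w) (𝓝[>] 0) (𝓝 0) := by
  have hU : Continuous (deriv (radial n f)) := (contDiff_radial hf).continuous_deriv (by simp)
  have hcont : Continuous fun w => √w * deriv (radial n f) (√w) / 2 := by fun_prop
  have hlim := hcont.tendsto 0
  rw [Real.sqrt_zero, zero_mul, zero_div] at hlim
  refine (hlim.mono_left nhdsWithin_le_nhds).congr' ?_
  filter_upwards [self_mem_nhdsWithin] with w hw
  exact (mul_deriv_profile hf hw).symm

lemma chart_zero_eq_chart_one (n : ℕ) {t : ℝ} (ht : 0 < t) :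
    chart n 0 ![t, 0, 0, 0] = chart n 1 ![0, 0, t⁻¹, 0] := by
  refine Quotient.sound ⟨t⁻¹, inv_pos.2 ht, 1, ?_, ?_⟩
  · ext i
    fin_cases i <;> simp [homChart, Complex.ext_iff, ht.ne']
  · simp [homChart, Complex.ext_iff]

/-- The restriction of a function to a real line in a fibre of `𝒪(-n)`, as a function of the
fibre coordinate of the bundle chart, which is `1 / s` on the positive half-line. -/
def bundleRadial (n : ℕ) (f : Orb n → ℝ) (y : ℝ) : ℝ := f (chart n 1 ![0, 0, y, 0])

lemma contDiff_bundleRadial (hf : f ∈ X n) : ContDiff ℝ ∞ (bundleRadial n f) := by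
  refine (hf.1 1).comp (contDiff_pi.2 fun i => ?_)
  fin_cases i
  exacts [contDiff_const, contDiff_const, contDiff_id, contDiff_const]

lemma radial_eq_bundleRadial_inv (f : Orb n → ℝ) {t : ℝ} (ht : 0 < t) :
    radial n f t = bundleRadial n f t⁻¹ :=
  congrArg f (chart_zero_eq_chart_one n ht)

lemma deriv_radial_eq (hf : f ∈ X n) {t : ℝ} (ht : 0 < t) :
    deriv (radial n f) t = -deriv (bundleRadial n f) t⁻¹ / t ^ 2 := by
  have hV : HasDerivAt (bundleRadial n f) (deriv (bundleRadial n f) t⁻¹) t⁻¹ :=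
    ((contDiff_bundleRadial hf).differentiable (by simp) _).hasDerivAt
  have h_eq : radial n f =ᶠ[𝓝 t] bundleRadial n f ∘ (·⁻¹) := by
    filter_upwards [lt_mem_nhds ht] with r hr
    exact radial_eq_bundleRadial_inv f hr
  rw [h_eq.deriv_eq, (hV.comp t (hasDerivAt_inv ht.ne')).deriv]
  ring

lemma tendsto_inv_sqrt_atTop : Tendsto (fun w : ℝ => (√w)⁻¹) atTop (𝓝 0) :=
  tendsto_inv_atTop_zero.comp Real.tendsto_sqrt_atTop

lemma tendsto_profile_atTop (hf : f ∈ X n) :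
    Tendsto (profile n f) atTop (𝓝 (bundleRadial n f 0)) := by
  refine (((contDiff_bundleRadial hf).continuous.tendsto 0).comp tendsto_inv_sqrt_atTop).congr' ?_
  filter_upwards [eventually_gt_atTop 0] with w hw
  exact (radial_eq_bundleRadial_inv f (Real.sqrt_pos.2 hw)).symm

lemma tendsto_sqrt_mul_deriv_profile_atTop (hf : f ∈ X n) :
    Tendsto (fun w => √w * (w * deriv (profile n f) w)) atTop
      (𝓝 (-deriv (bundleRadial n f) 0 / 2)) := by
  have hV : Continuous (deriv (bundleRadial n f)) :=
    (contDiff_bundleRadial hf).continuous_deriv (by simp)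
  refine (((hV.tendsto 0).comp tendsto_inv_sqrt_atTop).neg.div_const 2).congr' ?_
  filter_upwards [eventually_gt_atTop 0] with w hw
  have h_sqrt : 0 < √w := Real.sqrt_pos.2 hw
  rw [mul_deriv_profile hf hw, deriv_radial_eq hf h_sqrt, Function.comp_apply]
  field_simp

lemma s_axis (n : ℕ) {t : ℝ} (ht : 0 ≤ t) : s n (chart n 0 ![t, 0, 0, 0]) = ENNReal.ofReal t := by
  rw [chart, s_mk, wSq_homChart_zero, ySq_homChart_zero, normSq_axis, Real.sqrt_sq ht,
    Real.sqrt_one, ENNReal.ofReal_one, div_one]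

lemma antitone_profile (h : ∀ p p' : Orb n, s n p ≤ s n p' → f p' ≤ f p) :
    Antitone (profile n f) := fun v w hvw => by
  refine h _ _ ?_
  rw [s_axis n (Real.sqrt_nonneg v), s_axis n (Real.sqrt_nonneg w)]
  gcongr

lemma factor_chart_zero (hn : 1 ≤ n) (x : Fin 4 → ℝ) :
    factor n (chart n 0 x) = (2 + n * normSq x) / (n * (1 + normSq x)) := by
  rw [chart, factor_mk hn, wSq_homChart_zero, ySq_homChart_zero, mul_one]

lemma Solves.profile_ode {u K₂ : Orb n → ℝ} (hn : 1 ≤ n) (hu : u ∈ X n)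
    (hsol : Solves n (KMinus n K₂) u) (hw : 0 < w) :
    (1 + n * w) * (w * (1 + n * w) * deriv (deriv (profile n u)) w
        + (2 + n * w) * deriv (profile n u) w) - n * profile n u w
      = -((2 + n * w) / (4 * n * (1 + n * w)) * profile n K₂ w * profile n u w ^ 3) := by
  have : (0 : ℝ) < n := by exact_mod_cast hn
  have hsq : √w ^ 2 = w := Real.sq_sqrt hw.le
  have heq := hsol 0 ![√w, 0, 0, 0]
  rw [KMinus, factor_chart_zero hn, normSq_axis, comp_chart_zero_eq_profile hu,
    laplacian_metric_axis (hsq.symm ▸ contDiffAt_infty.1 (contDiffAt_profile hu hw) 2),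
    scalarCurvature_metric_axis (Real.sqrt_pos.2 hw).ne', hsq] at heq
  simp only [profile, radial]
  linear_combination (norm := (field_simp; ring)) (-(1 + w) / (4 * (1 + n * w))) * heq

theorem not_exists_solves_KMinus {K₂ : Orb n → ℝ} (hn : 1 ≤ n) (hK : K₂ ∈ X n)
    (hmono : ∀ p p' : Orb n, s n p ≤ s n p' → K₂ p' ≤ K₂ p) :
    ¬ ∃ u ∈ X n, Solves n (KMinus n K₂) u := by
  rintro ⟨u, hu, hsol⟩
  exact EmdenFowler.false_of_ode (N := n) (φ := profile n u) (κ := profile n K₂)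
    (by exact_mod_cast hn) (fun w hw => contDiffAt_infty.1 (contDiffAt_profile hu hw) 2)
    (fun w hw => (contDiffAt_profile hK hw).differentiableAt (by simp))
    (fun w _ => profile_pos hu w) (fun w _ => profile_pos hK w)
    (fun w _ => (antitone_profile hmono).deriv_nonpos) (fun w hw => hsol.profile_ode hn hu hw)
    (tendsto_profile_nhdsGT_zero hu) (tendsto_profile_nhdsGT_zero hK)
    (tendsto_mul_deriv_profile_nhdsGT_zero hu) (tendsto_profile_atTop hu)
    (tendsto_profile_atTop hK) (tendsto_sqrt_mul_deriv_profile_atTop hu)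

theorem not_exists_solves_const {c : ℝ} (hn : 2 ≤ n) (hc : 0 < c) :
    ¬ ∃ u ∈ X n, Solves n (fun _ => c) u := by
  have hn₁ : 1 ≤ n := one_le_two.trans hn
  have hF := factor_mem_X hn₁
  have h_eq : KMinus n (fun p => c / factor n p) = fun _ => c :=
    funext fun p => mul_div_cancel₀ c (hF.2.2 p).ne'
  rw [← h_eq]
  refine not_exists_solves_KMinus hn₁ (const_div_mem_X hF hc) fun p p' hs => ?_
  exact div_le_div_of_nonneg_left hc.le (hF.2.2 p) (factor_mono hn hs)

end Profile

section OrbifoldPoint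

variable {n : ℕ} {f : Orb n → ℝ}

lemma apply_chart_zero_single (hf : f ∈ X n) (i : Fin 4) (h : ℝ) :
    (f ∘ chart n 0) (Pi.single i h) = radial n f h := by
  have hnorm : normSq (Pi.single i h : Fin 4 → ℝ) = h ^ 2 := by simp [normSq, sq]
  rw [Function.comp_apply, apply_chart_zero hf, hnorm, Real.sqrt_sq_eq_abs, radial_abs hf]

lemma deriv_radial_zero (hf : f ∈ X n) : deriv (radial n f) 0 = 0 := by
  have heven : (fun t => radial n f (-t)) = radial n f :=
    funext fun t => by rw [← radial_abs hf, abs_neg, radial_abs hf]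
  have hodd := deriv_comp_neg (radial n f) 0
  rw [heven, neg_zero] at hodd
  linarith

lemma metric_zero_zero (n : ℕ) : metric n 0 0 = Matrix.diagonal fun _ => 1 := by
  rw [metric_zero_eq_radialMetric, Matrix.diagonal_one]
  simp [radialMetric, normSq, weight]

lemma laplacian_metric_zero (hf : f ∈ X n) :
    laplacian (metric n 0) (f ∘ chart n 0) 0 = 4 * iteratedDeriv 2 (radial n f) 0 := by
  have hline : ∀ i, (fun h => (f ∘ chart n 0) (Pi.single i h)) = radial n f :=
    fun i => funext (apply_chart_zero_single hf i)
  have hpd : ∀ i, pd i (f ∘ chart n 0) 0 = 0 := fun i => by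
    rw [← Pi.single_zero i, ← deriv_comp_single ((hf.1 0).differentiable (by simp)), hline,
      deriv_radial_zero hf]
  simp only [laplacian_of_diagonal (fun _ => one_ne_zero) (metric_zero_zero n), hpd,
    pd_pd_zero_eq_iteratedDeriv (contDiff_infty.1 (hf.1 0) 2), hline, mul_zero,
    Finset.sum_const_zero, sub_zero, inv_one, one_mul, Finset.sum_const, Finset.card_univ,
    Fintype.card_fin, nsmul_eq_mul, Nat.cast_ofNat]

lemma iteratedDeriv_two_add_mul_sq_mul {g : ℝ → ℝ} (hg : ContDiffAt ℝ 2 g 0) (a b : ℝ) :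
    iteratedDeriv 2 (fun t => (a + b * t ^ 2) * g t) 0
      = a * iteratedDeriv 2 g 0 + 2 * b * g 0 := by
  have hderiv : deriv (fun t : ℝ => a + b * t ^ 2) = fun t => 2 * b * t := by
    funext t
    simp [mul_left_comm, mul_assoc]
  rw [iteratedDeriv_fun_mul (by fun_prop) hg]
  simp [Finset.sum_range_succ, iteratedDeriv_succ, hderiv]

lemma radial_KMinus (hn : 1 ≤ n) (K₂ : Orb n → ℝ) (t : ℝ) :
    (n + n * t ^ 2) * radial n (KMinus n K₂) t = (2 + n * t ^ 2) * radial n K₂ t := by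
  have : (0 : ℝ) < n := by exact_mod_cast hn
  rw [radial, KMinus, factor_chart_zero hn, normSq_axis, radial]
  field_simp

lemma KMinus_mem_XNeg {K₂ : Orb n → ℝ} (hn : 1 ≤ n) (hK : K₂ ∈ X n)
    (h : iteratedDeriv 2 (radial n K₂) 0 < 0) : KMinus n K₂ ∈ XNeg n := by
  have : (0 : ℝ) < n := by exact_mod_cast hn
  have hKn := KMinus_mem_X hn hK
  have hq : n * radial n (KMinus n K₂) 0 = 2 * radial n K₂ 0 := by
    simpa using radial_KMinus hn K₂ 0
  have hderiv := congrArg (iteratedDeriv 2 · 0) (funext (radial_KMinus hn K₂))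
  simp only [iteratedDeriv_two_add_mul_sq_mul (contDiff_infty.1 (contDiff_radial hKn) 2).contDiffAt,
    iteratedDeriv_two_add_mul_sq_mul (contDiff_infty.1 (contDiff_radial hK) 2).contDiffAt] at hderiv
  have hq_axis : KMinus n K₂ (q n) = radial n (KMinus n K₂) 0 := by
    rw [q, ← Pi.single_zero 0]
    exact apply_chart_zero_single hKn 0 0
  have hsum : 4 * iteratedDeriv 2 (radial n (KMinus n K₂)) 0
      - 4 * ((n : ℝ) - 2) * radial n (KMinus n K₂) 0 = 8 / n * iteratedDeriv 2 (radial n K₂) 0 := by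
    field_simp
    linear_combination 4 * hderiv - 4 * n * hq
  refine ⟨hKn, ?_⟩
  rw [laplacian_metric_zero hKn, hq_axis, hsum]
  exact mul_neg_of_pos_of_neg (by positivity) h

end OrbifoldPoint

end LeBrun

end

theorem mainTheorem5 :
    (∀ n : ℕ, 1 ≤ n → ∀ K₂ ∈ LeBrun.X n,
      (∀ p p' : LeBrun.Orb n, LeBrun.s n p ≤ LeBrun.s n p' → K₂ p' ≤ K₂ p) →
        LeBrun.KMinus n K₂ ∈ LeBrun.X n ∧
        (¬ ∃ u ∈ LeBrun.X n, LeBrun.Solves n (LeBrun.KMinus n K₂) u) ∧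
        (iteratedDeriv 2 (LeBrun.radial n K₂) 0 < 0 →
          LeBrun.KMinus n K₂ ∈ LeBrun.XNeg n)) ∧
    (∀ n : ℕ, 2 ≤ n → ∀ c : ℝ, 0 < c →
      ¬ ∃ u ∈ LeBrun.X n, LeBrun.Solves n (fun _ => c) u) :=
  ⟨fun _ hn _ hK hmono => ⟨LeBrun.KMinus_mem_X hn hK, LeBrun.not_exists_solves_KMinus hn hK hmono,
    LeBrun.KMinus_mem_XNeg hn hK⟩, fun _ hn _ hc => LeBrun.not_exists_solves_const hn hc⟩
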